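/- **Setting.** Let $\Sigma$ be a finite alphabet, $\mathbb X\subseteq\Sigma^n$, and let $\rho,\sigma$ be $|\mathbb X|\times|\mathbb X|$ Gram matrices of unit vectors (positive semidefinite with unit diagonal). The adversary bound is the filtered $\gamma_2$ norm $\mathrm{Adv}^\star(\rho,\sigma)=\gamma_2(\rho-\sigma\,|\,\Delta)$, that is, the minimum of $$\max\Big\{\max_x\sum_j\|u_{x,j}\|^2,\ \max_y\sum_j\|v_{y,j}\|^2\Big\}$$ over all $m\in\mathbb N$ and vectors $u_{x,j},v_{y,j}\in\mathbb C^m$ such that $\rho_{x,y}-\sigma_{x,y}=\sum_{j:\,x_j\ne y_j}\langle u_{x,j}|v_{y,j}\rangle$ for all $x,y\in\mathbb X$. A continuous-time query algorithm of running time $T\ge 0$ acts on a finite-dimensional Hilbert space (a query part $\mathbb C^n\otimes\mathbb C^M$, plus possibly a summand on which the oracle acts as zero) by a Hamiltonian $H_x(t)=H_{\mathcal D}(t)+\alpha(t)\sum_{j=1}^n|j\rangle\langle j|\otimes h(x_j)$, $t\in[0,T]$, where $H_{\mathcal D}(t)$ is Hermitian, independent of $x$ and integrable in $t$, $\alpha$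 is real, measurable, with $|\alpha(t)|\le1$, and each $h(y)$, $y\in\Sigma$, is Hermitian with $\|h(y)\|\le1$. Let $\mathcal U_x$ be the resulting evolution from time $0$ to time $T$. The algorithm takes states $|\rho_x\rangle$ to states $|\sigma_x\rangle$ with error at most $\varepsilon$ (coherently) if $\mathrm{Re}\langle\sigma_x|\mathcal U_x|\rho_x\rangle\ge\sqrt{1-\varepsilon}$ for all $x\in\mathbb X$; it converts $\rho$ to $\sigma$ with error at most $\varepsilon$ if it does so for some states of its space with Gram matrices $\rho$ and $\sigma$. $Q^{\mathrm{ct}}_\varepsilon(\rho,\sigma)$ is the infimum of the running times of the algorithms converting $\rho$ to $\sigma$ with error at most $\varepsilon$. **Theorem 2.** 1. There is a universal constant $C>0$ such that, for all $\Sigma,n,\mathbb X,\rho,\sigma$ as above and all $\varepsilon\in(0,1]$, $$Q^{\mathrm{ct}}_\varepsilon(\rho,\sigma)\le C\,\frac{\mathrm{Adv}^\star(\rho,\sigma)}{\varepsilon}.$$ 2. (Algorithm AdiaConvert.) Put $W=\mathrm{Adv}^\star(\rho,\sigma)$. The minimum defining $W$ is attained, and: * if $0<\varepsilon\le1$ and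 $W<\varepsilon/2$, then doing nothing (running time $0$) converts $\rho$ to $\sigma$ with error at most $\varepsilon$; * if $0<\varepsilon\le 1/3$ and $W\ge\varepsilon/2$, let $\{|u_{x,i}\rangle,|v_{x,i}\rangle\}$ be any minimizer, with vectors in a workspace $\mathcal W$, and let $|\rho_x\rangle,|\sigma_x\rangle$ be any states with Gram matrices $\rho,\sigma$. On $\mathcal O\oplus(\mathcal Q\otimes\mathcal W)$, where $\mathcal O$ is the space of the states $|0,\rho_x\rangle,|1,\sigma_x\rangle$ and $\mathcal Q=\mathbb C^n\otimes\mathbb C^{\Sigma\cup\{\bar0\}}$, put $\theta(s)=\frac{\pi}{2}s$, $|y^-\rangle=(|\bar0\rangle-|y\rangle)/\sqrt2$, $$|\Psi_x^-(s,\varepsilon)\rangle=-\sin\theta(s)\,|0,\rho_x\rangle+\cos\theta(s)\,|1,\sigma_x\rangle+2\cos\theta(s)\sin\theta(s)\,\frac{\sqrt W}{\varepsilon}\sum_i|i,x_i^-\rangle|v_{x,i}\rangle,$$ let $\Lambda(s,\varepsilon)$ be the orthogonal projection onto $\mathrm{span}\{|\Psi_x^-(s,\varepsilon)\rangle: x\in\mathbb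 X\}$, and $\Pi_x=\sum_i|i,x_i^-\rangle\langle i,x_i^-|\otimes\mathbb 1_{\mathcal W}$. Then applying the Hamiltonian $\Lambda(t/\tau,\varepsilon)-\Pi_x$ for $t\in[0,\tau]$, $\tau=15\,W/\varepsilon^2$, is a continuous-time query algorithm (with $h(y)=|y^-\rangle\langle y^-|\otimes\mathbb 1_{\mathcal W}$ and $\alpha=-1$) that takes $|0,\rho_x\rangle$ to $|1,\sigma_x\rangle$ with error at most $9\varepsilon^2$. -/

import Mathlib

open MeasureTheory
open scoped Kronecker Matrix ComplexOrder

universe u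

noncomputable section

namespace QueryConversion

/-! ### Gram matrices and the adversary bound -/

/-- Gram matrix `⟨ψ_x, ψ_y⟩` of a family of normalized quantum states. -/
def IsGram {X : Type*} [Fintype X] (ρ : Matrix X X ℂ) : Prop :=
  ρ.PosSemidef ∧ ∀ x, ρ x x = 1

/-- The family of vectors `ψ` has Gram matrix `ρ`. -/
def HasGram {X E : Type*} [NormedAddCommGroup E] [InnerProductSpace ℂ E]
    (ψ : X → E) (ρ : Matrix X X ℂ) : Prop :=
  ∀ x y, inner ℂ (ψ x) (ψ y) = ρ x y

/-- `(u, v)` is a feasible point, of objective value at most `c`, of the minimization problem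
defining the filtered `γ₂` norm `γ₂(A | Z)`. -/
structure IsWitness {X Y : Type*} {n m : ℕ} (A : Matrix X Y ℂ) (Z : Fin n → Matrix X Y ℂ) (c : ℝ)
    (u : X → Fin n → EuclideanSpace ℂ (Fin m)) (v : Y → Fin n → EuclideanSpace ℂ (Fin m)) :
    Prop where
  nonneg : 0 ≤ c
  left_le : ∀ x, ∑ j, ‖u x j‖ ^ 2 ≤ c
  right_le : ∀ y, ∑ j, ‖v y j‖ ^ 2 ≤ c
  eq : ∀ x y, A x y = ∑ j, Z j x y * inner ℂ (u x j) (v y j)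

/-- Filtered `γ₂` norm: the smallest `c` such that `A = ∑ j, Z j ∘ (⟨u_{x,j}, v_{y,j}⟩)_{x,y}` with
`∑ j, ‖u_{x,j}‖² ≤ c` and `∑ j, ‖v_{y,j}‖² ≤ c` for all `x`, `y`. -/
def filteredGamma2 {X Y : Type*} {n : ℕ} (A : Matrix X Y ℂ) (Z : Fin n → Matrix X Y ℂ) : ℝ :=
  sInf {c : ℝ | ∃ (m : ℕ) (u : X → Fin n → EuclideanSpace ℂ (Fin m))
    (v : Y → Fin n → EuclideanSpace ℂ (Fin m)), IsWitness A Z c u v}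

/-- The filter matrices `(Δ_j)_{x,y} = 1 - δ_{x_j,y_j}`. -/
def filterMatrix {S : Type u} [DecidableEq S] {n : ℕ} (X : Finset (Fin n → S)) (j : Fin n) :
    Matrix X X ℂ :=
  Matrix.of fun x y => if x.1 j = y.1 j then 0 else 1

/-- The adversary bound `Adv⋆(ρ, σ) = γ₂(ρ - σ | Δ)`. -/
def advStar {S : Type u} [DecidableEq S] {n : ℕ} {X : Finset (Fin n → S)}
    (ρ σ : Matrix X X ℂ) : ℝ :=
  filteredGamma2 (ρ - σ) (filterMatrix X)

/-! ### Continuous-time query algorithms -/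

/-- State space `ℂ^O ⊕ (ℂⁿ ⊗ ℂ^M)`: registers not seen by the oracle, and the query register
`ℂⁿ` together with the space `ℂ^M` on which the operators `h y` act. -/
abbrev StateSpace (O M : Type u) (n : ℕ) : Type u := EuclideanSpace ℂ (O ⊕ Fin n × M)

/-- The isometry `w ↦ |j⟩ ⊗ w` into the query part of the state space. -/
def block (O M : Type u) [Fintype O] [Fintype M] {n : ℕ} (j : Fin n) :
    EuclideanSpace ℂ M →L[ℂ] StateSpace O M n :=
  LinearMap.toContinuousLinearMap
    { toFun := fun w => WithLp.toLp 2
        (Sum.elim (fun _ => 0) (fun p => if p.1 = j then w p.2 else 0))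
      map_add' := by
        intro a b
        ext p
        rcases p with o | ⟨k, q⟩
        · simp
        · by_cases hk : k = j <;> simp [hk]
      map_smul' := by
        intro c a
        ext p
        rcases p with o | ⟨k, q⟩
        · simp
        · by_cases hk : k = j <;> simp [hk] }

/-- The data of a continuous-time query algorithm: the spaces, the operators `h y` of the oracle,
the running time, the driver Hamiltonian and the coupling `α`. -/
structure QueryAlgorithm (S : Type u) (n : ℕ) : Type (u + 1) where
  O : Type u
  M : Type u
  [fintypeO : Fintype O]
  [fintypeM : Fintype M]
  h : S → (EuclideanSpace ℂ M →L[ℂ] EuclideanSpace ℂ M)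
  time : ℝ
  driver : ℝ → (StateSpace O M n →L[ℂ] StateSpace O M n)
  coupling : ℝ → ℝ

attribute [instance] QueryAlgorithm.fintypeO QueryAlgorithm.fintypeM

namespace QueryAlgorithm

variable {S : Type u} {n : ℕ}

/-- The Hilbert space of the algorithm. -/
abbrev Space (a : QueryAlgorithm S n) : Type u := StateSpace a.O a.M n

/-- The oracle Hamiltonian `∑ j, |j⟩⟨j| ⊗ h (x j)`. -/
def oracle (a : QueryAlgorithm S n) (x : Fin n → S) : a.Space →L[ℂ] a.Space :=
  ∑ j, block a.O a.M j ∘L a.h (x j) ∘L ContinuousLinearMap.adjoint (block a.O a.M j)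

/-- The total Hamiltonian `H_x(t) = H_D(t) + α(t) H_Q(x)`. -/
def hamiltonian (a : QueryAlgorithm S n) (x : Fin n → S) (t : ℝ) : a.Space →L[ℂ] a.Space :=
  a.driver t + (a.coupling t : ℂ) • a.oracle x

/-- The conditions on the data: `T ≥ 0`, the `h y` are Hermitian contractions, the driver
Hamiltonian is Hermitian and `|α| ≤ 1`; the time dependence is integrable on `[0, T]`. -/
structure IsValid (a : QueryAlgorithm S n) : Prop where
  time_nonneg : 0 ≤ a.time
  h_selfAdjoint : ∀ y, IsSelfAdjoint (a.h y)
  h_norm_le : ∀ y, ‖a.h y‖ ≤ 1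
  driver_selfAdjoint : ∀ t ∈ Set.Icc 0 a.time, IsSelfAdjoint (a.driver t)
  driver_integrable : IntervalIntegrable a.driver volume 0 a.time
  coupling_le : ∀ t ∈ Set.Icc 0 a.time, |a.coupling t| ≤ 1
  coupling_integrable : IntervalIntegrable a.coupling volume 0 a.time

/-- `φ` solves the Schrödinger equation `i φ' = H_x(t) φ` on `[0, T]`, in integrated form. -/
def IsTrajectory (a : QueryAlgorithm S n) (x : Fin n → S) (φ : ℝ → a.Space) : Prop :=
  ContinuousOn φ (Set.Icc 0 a.time) ∧ ∀ t ∈ Set.Icc 0 a.time,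
    φ t = φ 0 - Complex.I • ∫ s in (0 : ℝ)..t, a.hamiltonian x s (φ s)

/-- Coherent output condition: for every input `x`, the algorithm takes `init x` to a state whose
overlap with `target x` has real part at least `√(1 - ε)`. -/
def ConvertsStates (a : QueryAlgorithm S n) {X : Finset (Fin n → S)} (init target : X → a.Space)
    (ε : ℝ) : Prop :=
  ∀ x : X, ∃ φ : ℝ → a.Space, a.IsTrajectory x.1 φ ∧ φ 0 = init x ∧
    √(1 - ε) ≤ (inner ℂ (target x) (φ a.time)).re

/-- The algorithm converts `ρ` to `σ` with error at most `ε`. -/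
def Converts (a : QueryAlgorithm S n) {X : Finset (Fin n → S)} (ρ σ : Matrix X X ℂ)
    (ε : ℝ) : Prop :=
  ∃ init target : X → a.Space, HasGram init ρ ∧ HasGram target σ ∧ a.ConvertsStates init target ε

end QueryAlgorithm

/-- Some continuous-time query algorithm of running time `T` converts `ρ` to `σ` with error at
most `ε`. -/
def SolvableInTime {S : Type u} {n : ℕ} {X : Finset (Fin n → S)} (ρ σ : Matrix X X ℂ)
    (ε T : ℝ) : Prop :=
  ∃ a : QueryAlgorithm S n, a.IsValid ∧ a.time = T ∧ a.Converts ρ σ ε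

/-- The continuous-time bounded-error quantum query complexity (`⊤` if there is no algorithm). -/
def queryComplexity {S : Type u} {n : ℕ} {X : Finset (Fin n → S)} (ε : ℝ)
    (ρ σ : Matrix X X ℂ) : ENNReal :=
  ⨅ (T : ℝ) (_ : SolvableInTime ρ σ ε T), ENNReal.ofReal T

/-! ### The adiabatic algorithm -/

section AdiaConvert

variable {S : Type u} [DecidableEq S]

/-- The state `|y⁻⟩ = (|blank⟩ - |y⟩) / √2`; the blank symbol is `none`. -/
def minusState (y : S) (c : Option S) : ℂ :=
  ((1 / √2 : ℝ) : ℂ) * (if c = none then 1 else if c = some y then -1 else 0)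

/-- The operator `|y⁻⟩⟨y⁻| ⊗ 1` on the oracle output register and an `m`-dimensional workspace. -/
def standardOracle [Fintype S] (m : ℕ) (y : S) :
    EuclideanSpace ℂ (Option S × Fin m) →L[ℂ] EuclideanSpace ℂ (Option S × Fin m) :=
  Matrix.toEuclideanCLM (𝕜 := ℂ)
    (Matrix.vecMulVec (minusState y) (star (minusState y)) ⊗ₖ (1 : Matrix (Fin m) (Fin m) ℂ))

variable {n m : ℕ} {X : Finset (Fin n → S)} {D : Type u}

/-- The vector `|b⟩ ⊗ w` of the output register (with `b = false` for `|0⟩`, `b = true`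
for `|1⟩`). -/
def outputState (S : Type u) (n m : ℕ) (b : Bool) (w : EuclideanSpace ℂ D) :
    StateSpace (Bool × D) (Option S × Fin m) n :=
  WithLp.toLp 2 (Sum.elim (fun p => if p.1 = b then w p.2 else 0) (fun _ => 0))

/-- The vector `∑ i, |i⟩ ⊗ |x_i⁻⟩ ⊗ |v_i⟩` of the query part. -/
def queryState (D : Type u) (x : Fin n → S) (v : Fin n → EuclideanSpace ℂ (Fin m)) :
    StateSpace (Bool × D) (Option S × Fin m) n :=
  WithLp.toLp 2 (Sum.elim (fun _ => 0) (fun p => minusState (x p.1) p.2.1 * v p.1 p.2.2))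

/-- The angle `θ(s) = π s / 2`. -/
def angle (s : ℝ) : ℝ := Real.pi / 2 * s

/-- The vector `|k_x⁻(s)⟩ = - sin θ(s) |0, ρ_x⟩ + cos θ(s) |1, σ_x⟩`. -/
def kMinus (n m : ℕ) {X : Finset (Fin n → S)} (r t : X → EuclideanSpace ℂ D) (x : X) (s : ℝ) :
    StateSpace (Bool × D) (Option S × Fin m) n :=
  ((-Real.sin (angle s) : ℝ) : ℂ) • outputState S n m false (r x) +
    ((Real.cos (angle s) : ℝ) : ℂ) • outputState S n m true (t x)

/-- The vector `|Ψ_x⁻(s, ε)⟩ = |k_x⁻(s)⟩ + ξ(s) (√W / ε) ∑ i, |i, x_i⁻⟩ |v_{x,i}⟩`, where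
`ξ(s) = 2 cos θ(s) sin θ(s)`. -/
def psiMinus (W ε : ℝ) (r t : X → EuclideanSpace ℂ D)
    (v : X → Fin n → EuclideanSpace ℂ (Fin m)) (x : X) (s : ℝ) :
    StateSpace (Bool × D) (Option S × Fin m) n :=
  kMinus n m r t x s +
    ((2 * Real.cos (angle s) * Real.sin (angle s) * (√W / ε) : ℝ) : ℂ) • queryState D x.1 (v x)

/-- The orthogonal projection `Λ(s, ε)` on the span of the vectors `|Ψ_x⁻(s, ε)⟩`, `x ∈ X`. -/
def adiaDriver [Fintype S] [Fintype D] (W ε : ℝ) (r t : X → EuclideanSpace ℂ D)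
    (v : X → Fin n → EuclideanSpace ℂ (Fin m)) (s : ℝ) :
    StateSpace (Bool × D) (Option S × Fin m) n →L[ℂ]
      StateSpace (Bool × D) (Option S × Fin m) n :=
  (Submodule.span ℂ (Set.range fun x : X => psiMinus W ε r t v x s)).starProjection

/-- The adiabatic branch of AdiaConvert for states `r x` (initial) and `t x` (target), with
`W` the adversary bound and `v` part of an optimal witness for it: apply `Λ(s, ε) - Π_x`,
`s = time / τ`, for the time `τ = 15 W / ε²`, where `Π_x = ∑ i, |i, x_i⁻⟩⟨i, x_i⁻| ⊗ 1`. -/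
def adiaConvert [Fintype S] [Fintype D] (W ε : ℝ) (r t : X → EuclideanSpace ℂ D)
    (v : X → Fin n → EuclideanSpace ℂ (Fin m)) : QueryAlgorithm S n where
  O := Bool × D
  M := Option S × Fin m
  h := standardOracle m
  time := 15 * W / ε ^ 2
  driver := fun τ => adiaDriver W ε r t v (τ / (15 * W / ε ^ 2))
  coupling := fun _ => -1

end AdiaConvert

end QueryConversion

end

/-!
Both parts rest on one computation. For a feasible
point `(u, v)` of the adversary bound with value `W`, put `p_x = ∑ i, |i, x_i⁺⟩|u_{x,i}⟩` and
`q_x = ∑ i, |i, x_i⁻⟩|v_{x,i}⟩`. Since `⟨y⁺|z⁻⟩` is `1/2` for `y ≠ z` and `0` for `y = z`, the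
constraint of the adversary bound reads `⟨p_x, q_y⟩ = (ρ - σ)_{x,y} / 2`
(`inner_plusQueryState_queryState`); moreover `‖p_x‖², ‖q_x‖² ≤ W`, and the oracle projection `Π_x`
fixes `q_x` and kills `p_x`.

*Existence of optimal witnesses.* Projecting the `u`s on the span of the `v`s bounds the dimension,
so the minimum is taken over a compact set (`exists_isWitness_filteredGamma2`).

*Adiabatic evolution.* The vector `Ψ_x⁺ = cos θ |0, ρ_x⟩ + sin θ |1, σ_x⟩ + (ε / √W) p_x` is
orthogonal to every `Ψ_y⁻`, so it is an exact zero mode of `Λ - Π_x`, and `(Λ - Π_x) Ψ_x⁻` is the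
derivative of `Ψ_x⁺` with respect to `θ`. Hence `Ψ_x⁺ + (i π / 2 τ) Ψ_x⁻` solves the Schrödinger
equation up to a source of order `τ⁻²`, without any assumption on a spectral gap
(`norm_sub_le_of_zero_mode`). The projection `Λ` may jump where the dimension of the span changes, so
the equation is solved and estimated in integrated form, for bounded measurable Hamiltonians
(`exists_schroedinger_solution`, `abs_norm_sub_norm_le_of_schroedinger`).

*Doing nothing.* Here `ρ - σ` is the difference of the Gram matrices of `(p_x ± q_x) / √2`. For
positive weights on the inputs, the Powers–Størmer inequality (`powers_stormer`) gives realizations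
of `ρ` and `σ` with average overlap at least `1 - W`; the set of achievable overlaps is convex, so by
separation there are realizations with all overlaps above `1 - ε / 2`
(`exists_overlap_gt_of_average`).

*Bound on the complexity.* If `ε / 2 ≤ W` and `W` is of smaller order than `√ε`, a time of order
`W / ε` is too short for the adiabatic estimate with error `ε`, so another algorithm is used, with
states spread uniformly over `K` slots. In the presence of the catalyst `(p_x + q_x) / √2`, one
application of the reflection `1 - 2 Π_x` and one of an input-independent reflection convert one
slot exactly and return the catalyst (`step_progressState`). After normalization the catalyst has
norm at most `√(W / K)`, so leaving it out moves the final state by at most `2 √(W / K)`, which is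
small enough for `K ≥ 4 W / ε` (`solvableInTime_slots`). Each reflection is `exp (-i π Q)` for a
projection `Q`, hence takes time `π`.
-/

noncomputable section

set_option linter.unusedSectionVars false

namespace QueryConversion

/-! ### The oracle operator -/

section Oracle

variable {O M : Type u} [Fintype O] [Fintype M] {n : ℕ}

theorem block_apply_inl (j : Fin n) (w : EuclideanSpace ℂ M) (o : O) :
    block O M j w (Sum.inl o) = 0 := rfl

theorem block_apply_inr (j : Fin n) (w : EuclideanSpace ℂ M) (p : Fin n × M) :
    block O M j w (Sum.inr p) = if p.1 = j then w p.2 else 0 := rfl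

theorem adjoint_block_apply (j : Fin n) (φ : StateSpace O M n) :
    ContinuousLinearMap.adjoint (block O M j) φ =
      WithLp.toLp 2 fun q => φ (Sum.inr (j, q)) := by
  refine ext_inner_left ℂ fun w => ?_
  rw [ContinuousLinearMap.adjoint_inner_right]
  simp only [PiLp.inner_apply, Fintype.sum_sum_type, block_apply_inl, block_apply_inr,
    inner_zero_left, Finset.sum_const_zero, zero_add, Fintype.sum_prod_type]
  rw [Finset.sum_eq_single j]
  · simp
  · intro k _ hk
    simp [hk]
  · simp

variable {S : Type u}

/-- The operator `∑ j, |j⟩⟨j| ⊗ h (x j)` on the state space. -/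
def oracleOperator (O : Type u) [Fintype O] (h : S → (EuclideanSpace ℂ M →L[ℂ] EuclideanSpace ℂ M))
    (x : Fin n → S) : StateSpace O M n →L[ℂ] StateSpace O M n :=
  ∑ j, block O M j ∘L h (x j) ∘L ContinuousLinearMap.adjoint (block O M j)

theorem oracleOperator_apply (h : S → (EuclideanSpace ℂ M →L[ℂ] EuclideanSpace ℂ M))
    (x : Fin n → S) (φ : StateSpace O M n) :
    oracleOperator O h x φ = WithLp.toLp 2 (Sum.elim (fun _ => 0)
      fun p => h (x p.1) (WithLp.toLp 2 fun q => φ (Sum.inr (p.1, q))) p.2) := by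
  ext p
  simp only [oracleOperator, sum_apply, ContinuousLinearMap.comp_apply,
    adjoint_block_apply, WithLp.ofLp_sum, Finset.sum_apply]
  rcases p with o | p
  · simp [block_apply_inl]
  · simp [block_apply_inr]

theorem oracleOperator_isStarProjection
    {h : S → (EuclideanSpace ℂ M →L[ℂ] EuclideanSpace ℂ M)} (hh : ∀ y, IsStarProjection (h y))
    (x : Fin n → S) : IsStarProjection (oracleOperator O h x) := by
  constructor
  · unfold IsIdempotentElem
    ext φ p
    rw [mul_apply_eq_comp, oracleOperator_apply, oracleOperator_apply]
    rcases p with o | p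
    · rfl
    · have := congrArg (fun f : EuclideanSpace ℂ M →L[ℂ] EuclideanSpace ℂ M =>
        f (WithLp.toLp 2 fun q => φ (Sum.inr (p.1, q))) p.2) (hh (x p.1)).1
      simpa using this
  · exact isSelfAdjoint_sum (R := StateSpace O M n →L[ℂ] StateSpace O M n) _
      fun j _ => (hh (x j)).2.conj_adjoint _

end Oracle

/-! ### Vectors of the state space -/

section States

variable {S : Type u} [DecidableEq S]

/-- The state `|y⁺⟩ = (|blank⟩ + |y⟩) / √2`. -/
def plusState (y : S) (c : Option S) : ℂ :=
  ((1 / √2 : ℝ) : ℂ) * (if c = none then 1 else if c = some y then 1 else 0)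

theorem inv_sqrt_two_mul_self : ((1 / √2 : ℝ) : ℂ) * ((1 / √2 : ℝ) : ℂ) = 1 / 2 := by
  rw [← Complex.ofReal_mul, one_div_mul_one_div, Real.mul_self_sqrt (by norm_num)]
  norm_num

variable [Fintype S]

theorem sum_minusState_mul_minusState (y z : S) :
    ∑ c, star (minusState y c) * minusState z c = if y = z then 1 else 1 / 2 := by
  have h : ∀ c : Option S, star (minusState y c) * minusState z c =
      1 / 2 * ((if c = none then 1 else if c = some y then -1 else 0) *
        (if c = none then 1 else if c = some z then -1 else 0)) := by
    intro c
    rw [← inv_sqrt_two_mul_self]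
    simp only [minusState, star_mul', RCLike.star_def, Complex.conj_ofReal, apply_ite (starRingEnd ℂ),
      map_one, map_neg, map_zero]
    ring
  simp_rw [h, ← Finset.mul_sum, Fintype.sum_option]
  by_cases hyz : y = z
  · simp [hyz]; norm_num
  · simp [hyz, Ne.symm hyz]

theorem sum_plusState_mul_minusState (y z : S) :
    ∑ c, star (plusState y c) * minusState z c = if y = z then 0 else 1 / 2 := by
  have h : ∀ c : Option S, star (plusState y c) * minusState z c =
      1 / 2 * ((if c = none then 1 else if c = some y then 1 else 0) *
        (if c = none then 1 else if c = some z then -1 else 0)) := by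
    intro c
    rw [← inv_sqrt_two_mul_self]
    simp only [plusState, minusState, star_mul', RCLike.star_def, Complex.conj_ofReal,
      apply_ite (starRingEnd ℂ), map_one, map_zero]
    ring
  simp_rw [h, ← Finset.mul_sum, Fintype.sum_option]
  by_cases hyz : y = z
  · simp [hyz]
  · simp [hyz, Ne.symm hyz]

theorem sum_plusState_mul_plusState (y z : S) :
    ∑ c, star (plusState y c) * plusState z c = if y = z then 1 else 1 / 2 := by
  have h : ∀ c : Option S, star (plusState y c) * plusState z c =
      1 / 2 * ((if c = none then 1 else if c = some y then 1 else 0) *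
        (if c = none then 1 else if c = some z then 1 else 0)) := by
    intro c
    rw [← inv_sqrt_two_mul_self]
    simp only [plusState, star_mul', RCLike.star_def, Complex.conj_ofReal,
      apply_ite (starRingEnd ℂ), map_one, map_zero]
    ring
  simp_rw [h, ← Finset.mul_sum, Fintype.sum_option]
  by_cases hyz : y = z
  · simp [hyz]; norm_num
  · simp [hyz, Ne.symm hyz]

variable {D : Type u} [Fintype D] {n m : ℕ}

variable (D) in
/-- The vector `∑ i, |i⟩ ⊗ |a_i⟩ ⊗ |v_i⟩` of the query part. -/
def registerState (a : Fin n → Option S → ℂ) (v : Fin n → EuclideanSpace ℂ (Fin m)) :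
    StateSpace (Bool × D) (Option S × Fin m) n :=
  WithLp.toLp 2 (Sum.elim (fun _ => 0) (fun p => a p.1 p.2.1 * v p.1 p.2.2))

variable (D) in
/-- The vector `∑ i, |i⟩ ⊗ |x_i⁺⟩ ⊗ |u_i⟩` of the query part. -/
def plusQueryState (x : Fin n → S) (u : Fin n → EuclideanSpace ℂ (Fin m)) :
    StateSpace (Bool × D) (Option S × Fin m) n :=
  registerState D (fun i => plusState (x i)) u

theorem queryState_eq_registerState (x : Fin n → S) (v : Fin n → EuclideanSpace ℂ (Fin m)) :
    queryState D x v = registerState D (fun i => minusState (x i)) v := rfl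

theorem inner_registerState (a b : Fin n → Option S → ℂ)
    (v w : Fin n → EuclideanSpace ℂ (Fin m)) :
    inner ℂ (registerState D a v) (registerState D b w) =
      ∑ i, (∑ c, star (a i c) * b i c) * inner ℂ (v i) (w i) := by
  simp only [registerState, PiLp.inner_apply, Fintype.sum_sum_type, Fintype.sum_prod_type (γ := ℂ),
    Sum.elim_inl, Sum.elim_inr, Finset.sum_mul_sum, RCLike.inner_apply, map_mul, RCLike.star_def]
  rw [Finset.sum_eq_zero fun _ _ => by simp, zero_add]
  refine Finset.sum_congr rfl fun i _ => Finset.sum_congr rfl fun c _ =>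
    Finset.sum_congr rfl fun k _ => ?_
  ring

theorem inner_outputState (b c : Bool) (v w : EuclideanSpace ℂ D) :
    inner ℂ (outputState S n m b v) (outputState S n m c w) =
      if b = c then inner ℂ v w else 0 := by
  simp only [outputState, PiLp.inner_apply, Fintype.sum_sum_type, Fintype.sum_prod_type,
    Sum.elim_inl, Sum.elim_inr, inner_zero_left, Finset.sum_const_zero, add_zero]
  cases b <;> cases c <;> simp

theorem inner_outputState_registerState (b : Bool) (w : EuclideanSpace ℂ D)
    (a : Fin n → Option S → ℂ) (v : Fin n → EuclideanSpace ℂ (Fin m)) :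
    inner ℂ (outputState S n m b w) (registerState D a v) = 0 := by
  simp [outputState, registerState, PiLp.inner_apply, Fintype.sum_sum_type]

theorem inner_registerState_outputState (b : Bool) (w : EuclideanSpace ℂ D)
    (a : Fin n → Option S → ℂ) (v : Fin n → EuclideanSpace ℂ (Fin m)) :
    inner ℂ (registerState D a v) (outputState S n m b w) = 0 := by
  rw [← inner_conj_symm, inner_outputState_registerState, map_zero]

theorem norm_outputState (b : Bool) (w : EuclideanSpace ℂ D) :
    ‖outputState S n m b w‖ = ‖w‖ := by
  have h := inner_outputState (S := S) (n := n) (m := m) b b w w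
  rw [if_pos rfl, inner_self_eq_norm_sq_to_K, inner_self_eq_norm_sq_to_K] at h
  have h' : ‖outputState S n m b w‖ ^ 2 = ‖w‖ ^ 2 := by exact_mod_cast h
  exact (sq_eq_sq₀ (norm_nonneg _) (norm_nonneg _)).1 h'

theorem norm_sq_registerState {a : Fin n → Option S → ℂ} (ha : ∀ i, ∑ c, star (a i c) * a i c = 1)
    (v : Fin n → EuclideanSpace ℂ (Fin m)) :
    ‖registerState D a v‖ ^ 2 = ∑ i, ‖v i‖ ^ 2 := by
  have h := inner_registerState (D := D) a a v v
  simp only [ha, one_mul, inner_self_eq_norm_sq_to_K] at h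
  exact_mod_cast h

theorem norm_sq_queryState (x : Fin n → S) (v : Fin n → EuclideanSpace ℂ (Fin m)) :
    ‖queryState D x v‖ ^ 2 = ∑ i, ‖v i‖ ^ 2 := by
  rw [queryState_eq_registerState]
  exact norm_sq_registerState (fun i => by rw [sum_minusState_mul_minusState, if_pos rfl]) v

theorem norm_sq_plusQueryState (x : Fin n → S) (v : Fin n → EuclideanSpace ℂ (Fin m)) :
    ‖plusQueryState D x v‖ ^ 2 = ∑ i, ‖v i‖ ^ 2 :=
  norm_sq_registerState (fun i => by rw [sum_plusState_mul_plusState, if_pos rfl]) v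

/-- The overlap `⟨y⁺|z⁻⟩` is `1/2` if `y ≠ z` and `0` otherwise, which produces the filter of the
adversary bound. -/
theorem inner_plusQueryState_queryState {X : Finset (Fin n → S)} {A : Matrix X X ℂ} {c : ℝ}
    {u v : X → Fin n → EuclideanSpace ℂ (Fin m)} (h : IsWitness A (filterMatrix X) c u v)
    (x y : X) :
    inner ℂ (plusQueryState D x.1 (u x)) (queryState D y.1 (v y)) = A x y / 2 := by
  rw [queryState_eq_registerState, plusQueryState, inner_registerState, h.eq, Finset.sum_div]
  refine Finset.sum_congr rfl fun i _ => ?_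
  rw [sum_plusState_mul_minusState, filterMatrix, Matrix.of_apply]
  split_ifs <;> ring

theorem inner_plusQueryState_queryState_self (x : Fin n → S)
    (u v : Fin n → EuclideanSpace ℂ (Fin m)) :
    inner ℂ (plusQueryState D x u) (queryState D x v) = 0 := by
  rw [queryState_eq_registerState, plusQueryState, inner_registerState]
  simp only [sum_plusState_mul_minusState, if_true, zero_mul, Finset.sum_const_zero]

end States

/-! ### The standard oracle -/

section StandardOracle

variable {S : Type u} [DecidableEq S] [Fintype S] {D : Type u} [Fintype D] {n m : ℕ}

theorem standardOracle_isStarProjection (m : ℕ) (y : S) :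
    IsStarProjection (standardOracle m y) := by
  have h : star (minusState y) ⬝ᵥ minusState y = 1 := by
    have := sum_minusState_mul_minusState y y
    rwa [if_pos rfl] at this
  constructor
  · unfold IsIdempotentElem standardOracle
    rw [← map_mul, ← Matrix.mul_kronecker_mul, Matrix.vecMulVec_mul_vecMulVec, h, one_smul, one_mul]
  · unfold standardOracle
    rw [IsSelfAdjoint, ← map_star, Matrix.star_eq_conjTranspose, Matrix.conjTranspose_kronecker,
      Matrix.conjTranspose_vecMulVec, star_star, Matrix.conjTranspose_one]

theorem standardOracle_apply (y : S) (w : EuclideanSpace ℂ (Option S × Fin m))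
    (p : Option S × Fin m) :
    standardOracle m y w p = minusState y p.1 * ∑ c, star (minusState y c) * w (c, p.2) := by
  unfold standardOracle
  rw [Matrix.ofLp_toEuclideanCLM, Matrix.mulVec, dotProduct, Fintype.sum_prod_type, Finset.mul_sum]
  refine Finset.sum_congr rfl fun c _ => ?_
  simp [Matrix.kroneckerMap_apply, Matrix.vecMulVec_apply, Matrix.one_apply, mul_assoc]

/-- The projection `Π_x = ∑ i, |i, x_i⁻⟩⟨i, x_i⁻| ⊗ 1`. -/
def oracleProjection (D : Type u) [Fintype D] (m : ℕ) (x : Fin n → S) :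
    StateSpace (Bool × D) (Option S × Fin m) n →L[ℂ] StateSpace (Bool × D) (Option S × Fin m) n :=
  oracleOperator (Bool × D) (standardOracle m) x

theorem oracleProjection_isStarProjection (x : Fin n → S) :
    IsStarProjection (oracleProjection D m x) :=
  oracleOperator_isStarProjection (standardOracle_isStarProjection m) x

theorem oracleProjection_outputState (x : Fin n → S) (b : Bool) (w : EuclideanSpace ℂ D) :
    oracleProjection D m x (outputState S n m b w) = 0 := by
  ext p
  rw [oracleProjection, oracleOperator_apply]
  rcases p with o | p
  · rfl
  · simp only [Sum.elim_inr]
    refine (standardOracle_apply _ _ _).trans ?_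
    simp [outputState]

theorem oracleProjection_registerState (x : Fin n → S) (a : Fin n → Option S → ℂ)
    (v : Fin n → EuclideanSpace ℂ (Fin m)) :
    oracleProjection D m x (registerState D a v) = registerState D
      (fun i c => minusState (x i) c * ∑ c, star (minusState (x i) c) * a i c) v := by
  ext p
  rw [oracleProjection, oracleOperator_apply]
  rcases p with o | p
  · rfl
  · simp only [Sum.elim_inr]
    refine (standardOracle_apply _ _ _).trans ?_
    simp only [registerState, Sum.elim_inr]
    simp_rw [← mul_assoc]
    rw [← Finset.sum_mul, mul_assoc]

theorem oracleProjection_queryState (x : Fin n → S) (v : Fin n → EuclideanSpace ℂ (Fin m)) :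
    oracleProjection D m x (queryState D x v) = queryState D x v := by
  rw [queryState_eq_registerState, oracleProjection_registerState]
  simp only [sum_minusState_mul_minusState, if_true, mul_one]

theorem oracleProjection_plusQueryState (x : Fin n → S) (u : Fin n → EuclideanSpace ℂ (Fin m)) :
    oracleProjection D m x (plusQueryState D x u) = 0 := by
  rw [plusQueryState, oracleProjection_registerState]
  have h : ∀ i, ∑ c, star (minusState (x i) c) * plusState (x i) c = 0 := fun i => by
    have := congrArg star (sum_plusState_mul_minusState (x i) (x i))
    simpa [mul_comm] using this
  ext p
  rcases p with o | p
  · rfl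
  · simp only [registerState, Sum.elim_inr, h]
    simp

end StandardOracle

/-! ### The Schrödinger equation with a measurable Hamiltonian -/

section Schroedinger

/-- A function whose increments are at most `G h + C h²` in absolute value, `h` being the length of
the interval, is `G`-Lipschitz: the quadratic term disappears under subdivision. -/
theorem abs_sub_le_of_increment_le {f : ℝ → ℝ} {T G C : ℝ} (hT : 0 ≤ T)
    (h : ∀ a b, 0 ≤ a → a ≤ b → b ≤ T → |f b - f a| ≤ G * (b - a) + C * (b - a) ^ 2) :
    |f T - f 0| ≤ G * T := by
  have key : ∀ N : ℕ, 0 < N → |f T - f 0| ≤ G * T + C * T ^ 2 * (1 / (N : ℝ)) := by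
    intro N hN
    have hN' : (0 : ℝ) < N := by exact_mod_cast hN
    have step : ∀ k : ℕ, k ≤ N →
        |f (k * (T / N)) - f 0| ≤ k * (G * (T / N) + C * (T / N) ^ 2) := by
      intro k
      induction k with
      | zero => simp
      | succ k ih =>
        intro hk
        have h0 : 0 ≤ T / N := by positivity
        have hk' : ((k : ℝ) + 1) ≤ N := by exact_mod_cast hk
        have h1 := h (k * (T / N)) ((k + 1 : ℕ) * (T / N)) (by positivity)
          (by push_cast; nlinarith)
          (by
            push_cast
            calc ((k : ℝ) + 1) * (T / N) ≤ N * (T / N) := by gcongr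
              _ = T := by field_simp)
        have h2 := ih (by omega)
        have h3 : ((k + 1 : ℕ) : ℝ) * (T / N) - k * (T / N) = T / N := by push_cast; ring
        rw [h3] at h1
        calc |f ((k + 1 : ℕ) * (T / N)) - f 0|
            ≤ |f ((k + 1 : ℕ) * (T / N)) - f (k * (T / N))| + |f (k * (T / N)) - f 0| :=
              abs_sub_le _ _ _
          _ ≤ _ := by push_cast at h1 h2 ⊢; linarith
    have := step N le_rfl
    have h4 : (N : ℝ) * (T / N) = T := by field_simp
    rw [h4] at this
    calc |f T - f 0| ≤ N * (G * (T / N) + C * (T / N) ^ 2) := this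
      _ = _ := by field_simp
  have lim : Filter.Tendsto (fun N : ℕ => G * T + C * T ^ 2 * (1 / (N : ℝ))) Filter.atTop
      (nhds (G * T + C * T ^ 2 * 0)) :=
    (tendsto_one_div_atTop_nhds_zero_nat.const_mul _).const_add _
  rw [mul_zero, add_zero] at lim
  exact ge_of_tendsto lim (Filter.eventually_atTop.2 ⟨1, fun N hN => key N hN⟩)

variable {E : Type*} [NormedAddCommGroup E] [InnerProductSpace ℂ E] [CompleteSpace E]
  {H : ℝ → E →L[ℂ] E} {L : ℝ}

theorem intervalIntegrable_clm_apply {T : ℝ} {φ : ℝ → E} (hmeas : StronglyMeasurable H)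
    (hbound : ∀ t, ‖H t‖ ≤ L) (hφ : ContinuousOn φ (Set.Icc 0 T)) {a b : ℝ} (ha : 0 ≤ a)
    (hab : a ≤ b) (hb : b ≤ T) : IntervalIntegrable (fun s => H s (φ s)) volume a b := by
  have hsub : Set.uIcc a b ⊆ Set.Icc 0 T := by
    rw [Set.uIcc_of_le hab]; exact Set.Icc_subset_Icc ha hb
  have hφ' : IntervalIntegrable φ volume a b := (hφ.mono hsub).intervalIntegrable
  refine (hφ'.norm.const_mul L).mono_fun ?_ ?_
  · exact ContinuousLinearMap.aestronglyMeasurable_comp₂ (ContinuousLinearMap.id ℂ (E →L[ℂ] E))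
      hmeas.aestronglyMeasurable hφ'.def'.aestronglyMeasurable
  · refine Filter.Eventually.of_forall fun s => ?_
    change ‖_‖ ≤ ‖_‖
    rw [Real.norm_eq_abs]
    refine le_trans ?_ (le_abs_self _)
    exact (H s).le_of_opNorm_le (hbound s) _

/-- Existence of solutions of the Schrödinger equation for a bounded measurable Hamiltonian, in
integrated form. The Picard map is a contraction for the sup norm with weight `exp (-2 L t)`. -/
theorem exists_schroedinger_solution (hmeas : StronglyMeasurable H) (hL : 0 < L)
    (hbound : ∀ t, ‖H t‖ ≤ L) {T : ℝ} (hT : 0 ≤ T) (ψ : E) :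
    ∃ φ : ℝ → E, ContinuousOn φ (Set.Icc 0 T) ∧ φ 0 = ψ ∧
      ∀ t ∈ Set.Icc 0 T, φ t = ψ - Complex.I • ∫ s in (0 : ℝ)..t, H s (φ s) := by
  let w : ℝ → ℝ := fun s => Real.exp (2 * L * s)
  have hw : Continuous w := by fun_prop
  have hint : ∀ (η : C(Set.Icc (0 : ℝ) T, E)) (a b : ℝ),
      IntervalIntegrable (fun s => H s (w s • Set.IccExtend hT η s)) volume a b := by
    intro η a b
    have hc : Continuous fun s => w s • Set.IccExtend hT η s := by
      have : Continuous (Set.IccExtend hT η) := η.continuous.Icc_extend'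
      fun_prop
    have hφ' := hc.intervalIntegrable (μ := volume) a b
    refine (hφ'.norm.const_mul L).mono_fun ?_ ?_
    · exact ContinuousLinearMap.aestronglyMeasurable_comp₂ (ContinuousLinearMap.id ℂ (E →L[ℂ] E))
        hmeas.aestronglyMeasurable hφ'.def'.aestronglyMeasurable
    · refine Filter.Eventually.of_forall fun s => ?_
      change ‖_‖ ≤ ‖_‖
      rw [Real.norm_eq_abs]
      refine le_trans ?_ (le_abs_self _)
      exact (H s).le_of_opNorm_le (hbound s) _
  let F : C(Set.Icc (0 : ℝ) T, E) → C(Set.Icc (0 : ℝ) T, E) := fun η =>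
    ⟨fun t => (w t)⁻¹ • (ψ - Complex.I • ∫ s in (0 : ℝ)..t, H s (w s • Set.IccExtend hT η s)), by
      have h1 : Continuous fun t : ℝ => ∫ s in (0 : ℝ)..t, H s (w s • Set.IccExtend hT η s) :=
        intervalIntegral.continuous_primitive (hint η) 0
      have h2 : Continuous fun t : ℝ => (w t)⁻¹ := hw.inv₀ fun s => (Real.exp_pos _).ne'
      have h3 : Continuous fun t : ℝ =>
          (w t)⁻¹ • (ψ - Complex.I • ∫ s in (0 : ℝ)..t, H s (w s • Set.IccExtend hT η s)) := by
        fun_prop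
      exact h3.comp continuous_subtype_val⟩
  have hF : ContractingWith (1 / 2) F := by
    refine ⟨by rw [← NNReal.coe_lt_coe]; norm_num, LipschitzWith.of_dist_le_mul fun η₁ η₂ => ?_⟩
    rw [ContinuousMap.dist_le (by positivity)]
    rintro ⟨t, ht0, htT⟩
    have hdiff : F η₁ ⟨t, ht0, htT⟩ - F η₂ ⟨t, ht0, htT⟩ = -((w t)⁻¹ • Complex.I •
        ∫ s in (0 : ℝ)..t, H s (w s • (Set.IccExtend hT η₁ s - Set.IccExtend hT η₂ s))) := by
      change (w t)⁻¹ • (ψ - Complex.I • ∫ s in (0 : ℝ)..t, H s (w s • Set.IccExtend hT η₁ s)) -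
        (w t)⁻¹ • (ψ - Complex.I • ∫ s in (0 : ℝ)..t, H s (w s • Set.IccExtend hT η₂ s)) = _
      simp only [smul_sub, map_sub]
      rw [intervalIntegral.integral_sub (hint η₁ 0 t) (hint η₂ 0 t), smul_sub, smul_sub]
      abel
    have hbd : ‖∫ s in (0 : ℝ)..t,
        H s (w s • (Set.IccExtend hT η₁ s - Set.IccExtend hT η₂ s))‖ ≤
        ∫ s in (0 : ℝ)..t, w s * (L * dist η₁ η₂) := by
      refine intervalIntegral.norm_integral_le_of_norm_le ht0 ?_ ?_
      · refine Filter.Eventually.of_forall fun s _ => ?_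
        refine ((H s).le_of_opNorm_le (hbound s) _).trans ?_
        rw [norm_smul, Real.norm_eq_abs, abs_of_pos (Real.exp_pos _), mul_left_comm]
        have : ‖Set.IccExtend hT η₁ s - Set.IccExtend hT η₂ s‖ ≤ dist η₁ η₂ := by
          rw [← dist_eq_norm]
          exact ContinuousMap.dist_apply_le_dist _
        have h0 := (Real.exp_pos (2 * L * s)).le
        gcongr
      · exact (hw.mul continuous_const).intervalIntegrable _ _
    have hexp : ∫ s in (0 : ℝ)..t, w s = (w t - 1) / (2 * L) := by
      simp only [w]
      rw [intervalIntegral.integral_comp_mul_left (fun s => Real.exp s) (by positivity), integral_exp]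
      simp [div_eq_inv_mul]
    have hval : ∫ s in (0 : ℝ)..t, w s * (L * dist η₁ η₂) = (w t - 1) / 2 * dist η₁ η₂ := by
      rw [intervalIntegral.integral_mul_const, hexp]
      field_simp
    rw [dist_eq_norm, hdiff, norm_neg, norm_smul, norm_smul, Complex.norm_I, one_mul, norm_inv,
      Real.norm_eq_abs, abs_of_pos (Real.exp_pos _)]
    have hwt : 0 < w t := Real.exp_pos _
    calc (w t)⁻¹ * _ ≤ (w t)⁻¹ * ((w t - 1) / 2 * dist η₁ η₂) := by
          rw [← hval]; gcongr
      _ ≤ (w t)⁻¹ * (w t / 2 * dist η₁ η₂) := by gcongr; linarith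
      _ = _ := by push_cast; field_simp
  let η := hF.fixedPoint
  have hη : F η = η := hF.fixedPoint_isFixedPt
  have hext : ∀ t ∈ Set.Icc (0 : ℝ) T, w t • Set.IccExtend hT η t =
      ψ - Complex.I • ∫ s in (0 : ℝ)..t, H s (w s • Set.IccExtend hT η s) := by
    intro t ht
    rw [Set.IccExtend_of_mem hT η ht]
    conv_lhs => rw [← hη]
    exact smul_inv_smul₀ (Real.exp_pos _).ne' _
  refine ⟨fun t => w t • Set.IccExtend hT η t, ?_, ?_, hext⟩
  · have : Continuous (Set.IccExtend hT η) := η.continuous.Icc_extend'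
    exact (hw.smul this).continuousOn
  · simpa using hext 0 ⟨le_rfl, hT⟩

/-- Stability of the Schrödinger equation: a source term `g` of norm at most `G` changes the norm
by at most `G T` in time `T`. With `G = 0` this is unitarity. -/
theorem abs_norm_sub_norm_le_of_schroedinger (hmeas : StronglyMeasurable H)
    (hself : ∀ t, IsSelfAdjoint (H t)) (hL : 0 ≤ L) (hbound : ∀ t, ‖H t‖ ≤ L) {T G : ℝ}
    (hT : 0 ≤ T) (hG : 0 ≤ G) {η g : ℝ → E} (hη : ContinuousOn η (Set.Icc 0 T))
    (hg : ContinuousOn g (Set.Icc 0 T)) (hgG : ∀ t ∈ Set.Icc 0 T, ‖g t‖ ≤ G)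
    (heq : ∀ t ∈ Set.Icc 0 T, η t =
      η 0 - Complex.I • (∫ s in (0 : ℝ)..t, H s (η s)) - ∫ s in (0 : ℝ)..t, g s) :
    |‖η T‖ - ‖η 0‖| ≤ G * T := by
  obtain ⟨B, hB⟩ := isCompact_Icc.exists_bound_of_continuousOn hη
  have hB0 : 0 ≤ B := (norm_nonneg _).trans (hB 0 ⟨le_rfl, hT⟩)
  have hHint : ∀ a b, 0 ≤ a → a ≤ b → b ≤ T →
      IntervalIntegrable (fun s => H s (η s)) volume a b := fun a b ha hab hb =>
    intervalIntegrable_clm_apply hmeas hbound hη ha hab hb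
  have hgint : ∀ a b, 0 ≤ a → a ≤ b → b ≤ T → IntervalIntegrable g volume a b :=
    fun a b ha hab hb => (hg.mono (by
      rw [Set.uIcc_of_le hab]; exact Set.Icc_subset_Icc ha hb)).intervalIntegrable
  have hstep : ∀ a b, 0 ≤ a → a ≤ b → b ≤ T →
      η b = η a - Complex.I • (∫ s in a..b, H s (η s)) - ∫ s in a..b, g s := by
    intro a b ha hab hb
    have h1 := heq a ⟨ha, hab.trans hb⟩
    have h2 := heq b ⟨ha.trans hab, hb⟩
    rw [← intervalIntegral.integral_add_adjacent_intervals
      (hHint 0 a le_rfl ha (hab.trans hb)) (hHint a b ha hab hb),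
      ← intervalIntegral.integral_add_adjacent_intervals
      (hgint 0 a le_rfl ha (hab.trans hb)) (hgint a b ha hab hb)] at h2
    rw [h2, h1, smul_add]
    abel
  have hgbd : ∀ a b, 0 ≤ a → a ≤ b → b ≤ T → ‖∫ s in a..b, g s‖ ≤ G * (b - a) := by
    intro a b ha hab hb
    have := intervalIntegral.norm_integral_le_of_norm_le_const (a := a) (b := b) (f := g) (C := G)
      fun s hs => hgG s ⟨by rw [Set.uIoc_of_le hab] at hs; exact ha.trans hs.1.le,
        by rw [Set.uIoc_of_le hab] at hs; exact hs.2.trans hb⟩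
    rwa [abs_of_nonneg (sub_nonneg.2 hab)] at this
  have hlip : ∀ a b, 0 ≤ a → a ≤ b → b ≤ T → ‖η b - η a‖ ≤ (L * B + G) * (b - a) := by
    intro a b ha hab hb
    have h1 : ‖∫ s in a..b, H s (η s)‖ ≤ (L * B) * (b - a) := by
      have := intervalIntegral.norm_integral_le_of_norm_le_const (a := a) (b := b)
        (f := fun s => H s (η s)) (C := L * B) fun s hs => by
          rw [Set.uIoc_of_le hab] at hs
          refine ((H s).le_of_opNorm_le (hbound s) _).trans ?_
          gcongr
          exact hB s ⟨ha.trans hs.1.le, hs.2.trans hb⟩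
      rwa [abs_of_nonneg (sub_nonneg.2 hab)] at this
    have h2 : η b - η a = -(Complex.I • (∫ s in a..b, H s (η s))) - ∫ s in a..b, g s := by
      rw [hstep a b ha hab hb]; abel
    rw [h2]
    refine (norm_sub_le _ _).trans ?_
    rw [norm_neg, norm_smul, Complex.norm_I, one_mul]
    linarith [hgbd a b ha hab hb]
  refine abs_sub_le_of_increment_le (f := fun t => ‖η t‖) (C := L ^ 2 * B + L * (L * B + G)) hT ?_
  intro a b ha hab hb
  have hh : 0 ≤ b - a := sub_nonneg.2 hab
  have hηa : ‖η a‖ ≤ B := hB a ⟨ha, hab.trans hb⟩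
  have hcint : IntervalIntegrable (fun s => H s (η a)) volume a b :=
    intervalIntegrable_clm_apply hmeas hbound continuousOn_const ha hab hb
  set k := ∫ s in a..b, H s (η a) with hk
  set e := ∫ s in a..b, H s (η s - η a) with he
  have hsplit : η b = (η a - Complex.I • k) - Complex.I • e - ∫ s in a..b, g s := by
    rw [hstep a b ha hab hb, he, hk]
    simp only [map_sub]
    rw [intervalIntegral.integral_sub (hHint a b ha hab hb) hcint, smul_sub]
    abel
  have hkn : ‖k‖ ≤ L * ‖η a‖ * (b - a) := by
    have := intervalIntegral.norm_integral_le_of_norm_le_const (a := a) (b := b)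
      (f := fun s => H s (η a)) (C := L * ‖η a‖) fun s _ => (H s).le_of_opNorm_le (hbound s) _
    rwa [abs_of_nonneg hh] at this
  have hen : ‖e‖ ≤ L * ((L * B + G) * (b - a)) * (b - a) := by
    have := intervalIntegral.norm_integral_le_of_norm_le_const (a := a) (b := b)
      (f := fun s => H s (η s - η a)) (C := L * ((L * B + G) * (b - a))) fun s hs => by
        rw [Set.uIoc_of_le hab] at hs
        refine ((H s).le_of_opNorm_le (hbound s) _).trans ?_
        have h1 := hlip a s ha hs.1.le (hs.2.trans hb)
        have h2 : (L * B + G) * (s - a) ≤ (L * B + G) * (b - a) := by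
          gcongr; exact hs.2
        gcongr
        exact h1.trans h2
    rwa [abs_of_nonneg hh] at this
  -- The Hamiltonian is Hermitian, so its averaged action on `η a` is orthogonal over `ℝ` to `η a`.
  have horth : (inner ℂ (η a) (Complex.I • k)).re = 0 := by
    have hreal : (starRingEnd ℂ) (inner ℂ (η a) k) = inner ℂ (η a) k := by
      have h1 : inner ℂ (η a) k = ∫ s in a..b, inner ℂ (η a) (H s (η a)) := by
        rw [hk]
        exact ((innerSL ℂ (η a)).intervalIntegral_comp_comm hcint).symm
      rw [h1, ← intervalIntegral.intervalIntegral_conj]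
      congr 1
      ext s
      rw [inner_conj_symm]
      exact ContinuousLinearMap.isSelfAdjoint_iff_isSymmetric.1 (hself s) _ _
    rw [inner_smul_right, Complex.mul_re, Complex.I_re, Complex.I_im, zero_mul, one_mul, zero_sub,
      neg_eq_zero]
    exact Complex.conj_eq_iff_im.1 hreal
  have hsq : ‖η a - Complex.I • k‖ ^ 2 = ‖η a‖ ^ 2 + ‖k‖ ^ 2 := by
    rw [@norm_sub_sq ℂ]
    simp only [RCLike.re_to_complex, horth, norm_smul, Complex.norm_I, one_mul]
    ring
  have hlow : ‖η a‖ ≤ ‖η a - Complex.I • k‖ := by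
    refine le_of_sq_le_sq ?_ (norm_nonneg _)
    rw [hsq]; nlinarith [sq_nonneg ‖k‖]
  have hup : ‖η a - Complex.I • k‖ ≤ ‖η a‖ + L ^ 2 * B * (b - a) ^ 2 := by
    have h1 : ‖η a - Complex.I • k‖ ≤ ‖η a‖ * (1 + L ^ 2 * (b - a) ^ 2) := by
      refine le_of_sq_le_sq ?_ (by positivity)
      rw [hsq]
      have : ‖k‖ ^ 2 ≤ (L * ‖η a‖ * (b - a)) ^ 2 := by gcongr
      have h2 : 0 ≤ ‖η a‖ ^ 2 * (L ^ 2 * (b - a) ^ 2) := by positivity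
      have h3 : 0 ≤ ‖η a‖ ^ 2 * (L ^ 2 * (b - a) ^ 2) ^ 2 := by positivity
      nlinarith
    have h2 : ‖η a‖ * (L ^ 2 * (b - a) ^ 2) ≤ B * (L ^ 2 * (b - a) ^ 2) := by gcongr
    linarith
  have hrest : |‖η b‖ - ‖η a - Complex.I • k‖| ≤
      G * (b - a) + L * (L * B + G) * (b - a) ^ 2 := by
    refine (abs_norm_sub_norm_le _ _).trans ?_
    have : η b - (η a - Complex.I • k) = -(Complex.I • e) - ∫ s in a..b, g s := by
      rw [hsplit]; abel
    rw [this]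
    refine (norm_sub_le _ _).trans ?_
    rw [norm_neg, norm_smul, Complex.norm_I, one_mul]
    linarith [hgbd a b ha hab hb]
  rw [abs_le] at hrest ⊢
  have hpos : 0 ≤ L ^ 2 * B * (b - a) ^ 2 := by positivity
  constructor <;> linarith [hrest.1, hrest.2]

end Schroedinger

/-! ### Measurability of projections -/

section Measurability

variable {E : Type*} [NormedAddCommGroup E] [InnerProductSpace ℂ E] [FiniteDimensional ℂ E]

theorem starProjection_span_singleton_eq_rankOne (w : E) :
    (Submodule.span ℂ {w}).starProjection =
      ((‖w‖ ^ 2 : ℝ) : ℂ)⁻¹ • InnerProductSpace.rankOne ℂ w w := by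
  ext z
  rw [Submodule.starProjection_singleton, smul_apply,
    InnerProductSpace.rankOne_apply, smul_smul, div_eq_inv_mul]
  rfl

/-- One step of the Gram–Schmidt process, for projections. -/
theorem starProjection_span_insert (v : E) (s : Set E) :
    (Submodule.span ℂ (insert v s)).starProjection = (Submodule.span ℂ s).starProjection +
      (Submodule.span ℂ {v - (Submodule.span ℂ s).starProjection v}).starProjection := by
  set K := Submodule.span ℂ s with hK
  set w := v - K.starProjection v with hw
  have hwK : w ∈ Kᗮ := by
    rw [Submodule.mem_orthogonal']
    exact fun z hz => Submodule.starProjection_inner_eq_zero v z hz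
  have hKle : K ≤ Submodule.span ℂ (insert v s) := Submodule.span_mono (Set.subset_insert _ _)
  have hwmem : w ∈ Submodule.span ℂ (insert v s) :=
    Submodule.sub_mem _ (Submodule.subset_span (Set.mem_insert _ _))
      (hKle (Submodule.starProjection_apply_mem _ _))
  ext z
  refine Submodule.eq_starProjection_of_mem_of_inner_eq_zero ?_ ?_
  · refine Submodule.add_mem _ (hKle (Submodule.starProjection_apply_mem _ _)) ?_
    exact (Submodule.span_singleton_le_iff_mem w _).2 hwmem (Submodule.starProjection_apply_mem _ _)
  · have horthK : ∀ y ∈ K, inner ℂ (z - (K.starProjection +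
        (Submodule.span ℂ {w}).starProjection) z) y = 0 := by
      intro y hy
      rw [add_apply, ← sub_sub, inner_sub_left,
        Submodule.starProjection_inner_eq_zero _ _ hy, zero_sub, neg_eq_zero,
        Submodule.starProjection_singleton, inner_smul_left,
        (Submodule.mem_orthogonal' _ _).1 hwK y hy, mul_zero]
    have horthw : inner ℂ (z - (K.starProjection +
        (Submodule.span ℂ {w}).starProjection) z) w = 0 := by
      rw [add_apply, add_comm, ← sub_sub, inner_sub_left,
        Submodule.starProjection_inner_eq_zero _ _ (Submodule.mem_span_singleton_self w),
        (Submodule.mem_orthogonal _ _).1 hwK _ (Submodule.starProjection_apply_mem _ _), sub_zero]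
    intro y hy
    induction hy using Submodule.span_induction with
    | mem y hy =>
      rcases hy with rfl | hy
      · have h1 := horthK _ (Submodule.starProjection_apply_mem K y)
        rw [hw, inner_sub_right, ← hw, h1, sub_zero] at horthw
        exact horthw
      · exact horthK y (Submodule.subset_span hy)
    | zero => exact inner_zero_right _
    | add a b _ _ ha hb => rw [inner_add_right, ha, hb, add_zero]
    | smul c a _ ha => rw [inner_smul_right, ha, mul_zero]

/-- The projection on the span of finitely many measurable vectors is measurable, although it jumps
where the dimension of the span changes. -/
theorem stronglyMeasurable_starProjection_span {ι : Type*} [Finite ι] {f : ι → ℝ → E}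
    (hf : ∀ i, StronglyMeasurable (f i)) :
    StronglyMeasurable fun t => (Submodule.span ℂ (Set.range fun i => f i t)).starProjection := by
  classical
  have := Fintype.ofFinite ι
  have key : ∀ s : Finset ι, StronglyMeasurable
      fun t => (Submodule.span ℂ ((fun i => f i t) '' s)).starProjection := by
    intro s
    induction s using Finset.induction_on with
    | empty =>
      simp only [Finset.coe_empty, Set.image_empty, Submodule.span_empty,
        Submodule.starProjection_bot]
      exact stronglyMeasurable_const
    | insert i s _ ih =>
      simp only [Finset.coe_insert, Set.image_insert_eq, starProjection_span_insert]
      refine ih.add ?_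
      simp only [starProjection_span_singleton_eq_rankOne]
      have hw : StronglyMeasurable fun t => f i t -
          (Submodule.span ℂ ((fun i => f i t) '' s)).starProjection (f i t) := by
        refine (hf i).sub ?_
        have hc : Continuous fun p : (E →L[ℂ] E) × E => p.1 p.2 := by fun_prop
        exact hc.comp_stronglyMeasurable (ih.prodMk (hf i))
      refine StronglyMeasurable.smul (𝕜 := ℂ) ?_ ?_
      · have h1 := ((hw.norm.pow 2).measurable.inv).complex_ofReal
        simp only [Pi.inv_apply, Complex.ofReal_inv] at h1
        exact h1.stronglyMeasurable
      · have hc : Continuous fun w : E => InnerProductSpace.rankOne ℂ w w := by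
          refine continuous_clm_apply.2 fun z => ?_
          simp only [InnerProductSpace.rankOne_apply]
          fun_prop
        exact hc.comp_stronglyMeasurable hw
  simpa using key Finset.univ

end Measurability

/-! ### Adiabatic evolution along exact zero modes -/

section ZeroMode

variable {E : Type*} [NormedAddCommGroup E] [InnerProductSpace ℂ E] [CompleteSpace E]
  {H : ℝ → E →L[ℂ] E} {L : ℝ}

/-- Adiabatic estimate without a spectral gap. If `p` is a curve of exact zero modes of `H` whose
velocity is `H q`, then `p + i q` solves the Schrödinger equation up to the source `i q'`. -/
theorem norm_sub_le_of_zero_mode (hmeas : StronglyMeasurable H)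
    (hself : ∀ t, IsSelfAdjoint (H t)) (hL : 0 ≤ L) (hbound : ∀ t, ‖H t‖ ≤ L) {T G : ℝ}
    (hT : 0 ≤ T) (hG : 0 ≤ G) {φ p q q' : ℝ → E} (hφc : ContinuousOn φ (Set.Icc 0 T))
    (hφ : ∀ t ∈ Set.Icc 0 T, φ t = φ 0 - Complex.I • ∫ s in (0 : ℝ)..t, H s (φ s))
    (hp : ∀ t, HasDerivAt p (H t (q t)) t) (hHp : ∀ t, H t (p t) = 0)
    (hq : ∀ t, HasDerivAt q (q' t) t) (hq'c : Continuous q') (hq'G : ∀ t, ‖q' t‖ ≤ G) :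
    ‖φ T - (p T + Complex.I • q T)‖ ≤ ‖φ 0 - (p 0 + Complex.I • q 0)‖ + G * T := by
  have hpc : Continuous p := continuous_iff_continuousAt.2 fun t => (hp t).continuousAt
  have hqc : Continuous q := continuous_iff_continuousAt.2 fun t => (hq t).continuousAt
  have key := abs_norm_sub_norm_le_of_schroedinger hmeas hself hL hbound hT hG
    (η := fun t => φ t - (p t + Complex.I • q t)) (g := fun t => Complex.I • q' t)
    (hφc.sub (by fun_prop)) (by fun_prop)
    (fun t _ => by rw [norm_smul, Complex.norm_I, one_mul]; exact hq'G t) ?_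
  · linarith [le_abs_self (‖φ T - (p T + Complex.I • q T)‖ - ‖φ 0 - (p 0 + Complex.I • q 0)‖)]
  · intro t ht
    have hq1 : IntervalIntegrable (fun s => H s (q s)) volume 0 t :=
      intervalIntegrable_clm_apply (T := T) hmeas hbound hqc.continuousOn le_rfl ht.1 ht.2
    have hφ1 : IntervalIntegrable (fun s => H s (φ s)) volume 0 t :=
      intervalIntegrable_clm_apply hmeas hbound hφc le_rfl ht.1 ht.2
    have h1 : ∫ s in (0 : ℝ)..t, H s (q s) = p t - p 0 :=
      intervalIntegral.integral_eq_sub_of_hasDerivAt (fun s _ => hp s) hq1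
    have h2 : ∫ s in (0 : ℝ)..t, q' s = q t - q 0 :=
      intervalIntegral.integral_eq_sub_of_hasDerivAt (fun s _ => hq s)
        (hq'c.intervalIntegrable _ _)
    have h3 : ∫ s in (0 : ℝ)..t, H s (φ s - (p s + Complex.I • q s)) =
        (∫ s in (0 : ℝ)..t, H s (φ s)) - Complex.I • (p t - p 0) := by
      simp only [map_sub, map_add, map_smul, hHp, zero_add]
      have hq2 : IntervalIntegrable (fun s => Complex.I • H s (q s)) volume 0 t :=
        hq1.smul Complex.I
      rw [intervalIntegral.integral_sub hφ1 hq2, intervalIntegral.integral_smul, h1]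
    rw [h3, intervalIntegral.integral_smul, h2, hφ t ht]
    simp only [smul_sub, smul_smul, Complex.I_mul_I, neg_one_smul]
    abel

end ZeroMode

theorem isSelfAdjoint_clm_sub {E : Type*} [NormedAddCommGroup E] [InnerProductSpace ℂ E]
    [CompleteSpace E] {A B : E →L[ℂ] E} (hA : IsSelfAdjoint A) (hB : IsSelfAdjoint B) :
    IsSelfAdjoint (A - B) := hA.sub hB

theorem clm_add_neg_one_smul {E : Type*} [NormedAddCommGroup E] [InnerProductSpace ℂ E]
    (A B : E →L[ℂ] E) : A + ((-1 : ℝ) : ℂ) • B = A - B := by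
  rw [Complex.ofReal_neg, Complex.ofReal_one, neg_one_smul, ← sub_eq_add_neg]

/-- For unit vectors, squared distance at most `c` gives overlap at least
`1 - c / 2 ≥ √(1 - c)`. -/
theorem sqrt_le_re_inner_of_norm_sub {E : Type*} [NormedAddCommGroup E] [InnerProductSpace ℂ E]
    {a b : E} (ha : ‖a‖ = 1) (hb : ‖b‖ = 1) {c : ℝ} (hc1 : c ≤ 1) (hc : ‖b - a‖ ^ 2 ≤ c) :
    √(1 - c) ≤ (inner ℂ a b).re := by
  have h1 : ‖b - a‖ ^ 2 = 2 - 2 * (inner ℂ a b).re := by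
    rw [@norm_sub_sq ℂ, ha, hb, ← inner_conj_symm]
    simp only [RCLike.re_to_complex, Complex.conj_re]
    ring
  have h2 : 1 - c / 2 ≤ (inner ℂ a b).re := by linarith
  refine le_trans ?_ h2
  rw [Real.sqrt_le_iff]
  constructor
  · linarith
  · nlinarith [sq_nonneg c]

theorem HasGram.norm_eq_one {X E : Type*} [Fintype X] [NormedAddCommGroup E]
    [InnerProductSpace ℂ E] {ψ : X → E} {ρ : Matrix X X ℂ} (h : HasGram ψ ρ) (hρ : IsGram ρ)
    (x : X) : ‖ψ x‖ = 1 := by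
  have h1 := h x x
  rw [hρ.2, inner_self_eq_norm_sq_to_K] at h1
  have h2 : ‖ψ x‖ ^ 2 = 1 := by
    have : ((‖ψ x‖ ^ 2 : ℝ) : ℂ) = 1 := by rw [← h1]; push_cast; rfl
    exact_mod_cast this
  exact (pow_eq_one_iff_of_nonneg (norm_nonneg _) two_ne_zero).1 h2

/-! ### The adiabatic algorithm -/

section AdiaConvert

variable {S : Type u} [DecidableEq S] [Fintype S] {D : Type u} [Fintype D] {n m : ℕ}
  {X : Finset (Fin n → S)}

theorem adiaDriver_isStarProjection (W ε : ℝ) (r t : X → EuclideanSpace ℂ D)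
    (v : X → Fin n → EuclideanSpace ℂ (Fin m)) (s : ℝ) :
    IsStarProjection (adiaDriver W ε r t v s) :=
  isStarProjection_starProjection

theorem continuous_angle : Continuous angle := by unfold angle; fun_prop

theorem stronglyMeasurable_adiaDriver (W ε : ℝ) (r t : X → EuclideanSpace ℂ D)
    (v : X → Fin n → EuclideanSpace ℂ (Fin m)) :
    StronglyMeasurable (adiaDriver W ε r t v) := by
  refine stronglyMeasurable_starProjection_span fun x => Continuous.stronglyMeasurable ?_
  have := continuous_angle
  unfold psiMinus kMinus
  fun_prop

theorem adiaConvert_isValid {W ε : ℝ} (hW : 0 ≤ W) (r t : X → EuclideanSpace ℂ D)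
    (v : X → Fin n → EuclideanSpace ℂ (Fin m)) : (adiaConvert W ε r t v).IsValid where
  time_nonneg := by change 0 ≤ 15 * W / ε ^ 2; positivity
  h_selfAdjoint y := (standardOracle_isStarProjection m y).isSelfAdjoint
  h_norm_le y := (standardOracle_isStarProjection m y).norm_le
  driver_selfAdjoint τ _ := (adiaDriver_isStarProjection W ε r t v _).isSelfAdjoint
  driver_integrable := by
    have hm : StronglyMeasurable fun τ => adiaDriver W ε r t v (τ / (15 * W / ε ^ 2)) :=
      (stronglyMeasurable_adiaDriver W ε r t v).comp_measurable (measurable_id.div_const _)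
    refine (intervalIntegrable_const (c := (1 : ℝ))).mono_fun hm.aestronglyMeasurable ?_
    refine Filter.Eventually.of_forall fun τ => ?_
    rw [norm_one]
    exact (adiaDriver_isStarProjection W ε r t v _).norm_le
  coupling_le _ _ := by change |(-1 : ℝ)| ≤ 1; norm_num
  coupling_integrable := intervalIntegrable_const

/-- The vector `|Ψ_x⁺⟩ = cos θ |0, ρ_x⟩ + sin θ |1, σ_x⟩ + (ε / √W) ∑ i, |i, x_i⁺⟩ |u_{x,i}⟩`, a zero
mode of the Hamiltonian. -/
def psiPlus (W ε : ℝ) (r t : X → EuclideanSpace ℂ D)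
    (u : X → Fin n → EuclideanSpace ℂ (Fin m)) (x : X) (s : ℝ) :
    StateSpace (Bool × D) (Option S × Fin m) n :=
  ((Real.cos (angle s) : ℝ) : ℂ) • outputState S n m false (r x) +
    ((Real.sin (angle s) : ℝ) : ℂ) • outputState S n m true (t x) +
    ((ε / √W : ℝ) : ℂ) • plusQueryState D x.1 (u x)

variable {ρ σ : Matrix X X ℂ} {r t : X → EuclideanSpace ℂ D}
  {u v : X → Fin n → EuclideanSpace ℂ (Fin m)} {W ε : ℝ}

theorem inner_psiMinus_psiPlus (hr : HasGram r ρ) (ht : HasGram t σ)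
    (h : IsWitness (ρ - σ) (filterMatrix X) W u v) (hW : 0 < W) (hε : 0 < ε) (x y : X) (s : ℝ) :
    inner ℂ (psiPlus W ε r t u x s) (psiMinus W ε r t v y s) = 0 := by
  have hWε : ((ε / √W : ℝ) : ℂ) * ((√W / ε : ℝ) : ℂ) = 1 := by
    have := Real.sqrt_pos.2 hW
    rw [← Complex.ofReal_mul]
    norm_cast
    field_simp
  have h0 := inner_plusQueryState_queryState (D := D) h x y
  rw [psiPlus, psiMinus, kMinus]
  simp only [inner_add_left, inner_add_right, inner_smul_left, inner_smul_right, inner_outputState,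
    queryState_eq_registerState, plusQueryState, inner_outputState_registerState,
    inner_registerState_outputState, hr x y, ht x y, Complex.conj_ofReal]
  rw [← queryState_eq_registerState, ← plusQueryState, h0]
  simp only [Matrix.sub_apply, Bool.false_eq_true, Bool.true_eq_false, if_true, if_false]
  push_cast at hWε ⊢
  linear_combination (Complex.cos (angle s) * Complex.sin (angle s) * (ρ x y - σ x y)) * hWε

/-- The Hamiltonian of AdiaConvert at the rescaled time `s`. -/
def adiaHamiltonian (W ε : ℝ) (r t : X → EuclideanSpace ℂ D)
    (v : X → Fin n → EuclideanSpace ℂ (Fin m)) (x : X) (s : ℝ) :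
    StateSpace (Bool × D) (Option S × Fin m) n →L[ℂ] StateSpace (Bool × D) (Option S × Fin m) n :=
  adiaDriver W ε r t v s - oracleProjection D m x.1

theorem adiaHamiltonian_psiPlus (hr : HasGram r ρ) (ht : HasGram t σ)
    (h : IsWitness (ρ - σ) (filterMatrix X) W u v) (hW : 0 < W) (hε : 0 < ε) (x : X) (s : ℝ) :
    adiaHamiltonian W ε r t v x s (psiPlus W ε r t u x s) = 0 := by
  have h1 : adiaDriver W ε r t v s (psiPlus W ε r t u x s) = 0 := by
    rw [adiaDriver, Submodule.starProjection_apply_eq_zero_iff, Submodule.mem_orthogonal']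
    intro w hw
    induction hw using Submodule.span_induction with
    | mem w hw =>
      obtain ⟨y, rfl⟩ := hw
      exact inner_psiMinus_psiPlus hr ht h hW hε x y s
    | zero => exact inner_zero_right _
    | add a b _ _ ha hb => rw [inner_add_right, ha, hb, add_zero]
    | smul c a _ ha => rw [inner_smul_right, ha, mul_zero]
  rw [adiaHamiltonian, sub_apply, h1, psiPlus]
  simp only [map_add, map_smul, oracleProjection_outputState, oracleProjection_plusQueryState,
    smul_zero, add_zero, sub_zero]

theorem adiaHamiltonian_psiMinus (W ε : ℝ) (r t : X → EuclideanSpace ℂ D)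
    (v : X → Fin n → EuclideanSpace ℂ (Fin m)) (x : X) (s : ℝ) :
    adiaHamiltonian W ε r t v x s (psiMinus W ε r t v x s) = kMinus n m r t x s := by
  have h1 : adiaDriver W ε r t v s (psiMinus W ε r t v x s) = psiMinus W ε r t v x s :=
    Submodule.starProjection_eq_self_iff.2 (Submodule.subset_span ⟨x, rfl⟩)
  rw [adiaHamiltonian, sub_apply, h1, psiMinus, kMinus]
  simp only [map_add, map_smul, oracleProjection_outputState, oracleProjection_queryState,
    smul_zero, add_zero, zero_add, add_sub_cancel_right]

theorem adiaHamiltonian_isSelfAdjoint (x : X) (s : ℝ) :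
    IsSelfAdjoint (adiaHamiltonian W ε r t v x s) := by
  have h1 := (adiaDriver_isStarProjection W ε r t v s).isSelfAdjoint
  have h2 := (oracleProjection_isStarProjection (D := D) (m := m) x.1).isSelfAdjoint
  exact isSelfAdjoint_clm_sub h1 h2

theorem norm_adiaHamiltonian_le (x : X) (s : ℝ) : ‖adiaHamiltonian W ε r t v x s‖ ≤ 2 := by
  refine (norm_sub_le _ _).trans ?_
  have h1 := (adiaDriver_isStarProjection W ε r t v s).norm_le
  have h2 := (oracleProjection_isStarProjection (D := D) (m := m) x.1).norm_le
  linarith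

theorem hasDerivAt_psiPlus (τ : ℝ) (x : X) (s : ℝ) :
    HasDerivAt (fun s => psiPlus W ε r t u x (s / τ))
      (((Real.pi / (2 * τ) : ℝ) : ℂ) • kMinus n m r t x (s / τ)) s := by
  have ha : HasDerivAt (fun s => angle (s / τ)) (Real.pi / (2 * τ)) s := by
    have := ((hasDerivAt_id s).div_const τ).const_mul (Real.pi / 2)
    convert! this using 1
    ring
  unfold psiPlus kMinus
  convert! ((ha.cos.ofReal_comp.smul_const (outputState S n m false (r x))).add
    (ha.sin.ofReal_comp.smul_const (outputState S n m true (t x)))).add_const _ using 1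
  rw [smul_add, smul_smul, smul_smul]
  push_cast
  congr 2 <;> ring

/-- The derivative of `θ ↦ |Ψ_x⁻⟩`. -/
def psiMinusDeriv (W ε : ℝ) (r t : X → EuclideanSpace ℂ D)
    (v : X → Fin n → EuclideanSpace ℂ (Fin m)) (x : X) (s : ℝ) :
    StateSpace (Bool × D) (Option S × Fin m) n :=
  ((-Real.cos (angle s) : ℝ) : ℂ) • outputState S n m false (r x) +
    ((-Real.sin (angle s) : ℝ) : ℂ) • outputState S n m true (t x) +
    ((2 * (Real.cos (angle s) ^ 2 - Real.sin (angle s) ^ 2) * (√W / ε) : ℝ) : ℂ) •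
      queryState D x.1 (v x)

theorem hasDerivAt_psiMinus (τ : ℝ) (x : X) (s : ℝ) :
    HasDerivAt (fun s => psiMinus W ε r t v x (s / τ))
      (((Real.pi / (2 * τ) : ℝ) : ℂ) • psiMinusDeriv W ε r t v x (s / τ)) s := by
  have ha : HasDerivAt (fun s => angle (s / τ)) (Real.pi / (2 * τ)) s := by
    have := ((hasDerivAt_id s).div_const τ).const_mul (Real.pi / 2)
    convert! this using 1
    ring
  have hb : HasDerivAt
      (fun s => 2 * Real.cos (angle (s / τ)) * Real.sin (angle (s / τ)) * (√W / ε))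
      (Real.pi / (2 * τ) * (2 * (Real.cos (angle (s / τ)) ^ 2 - Real.sin (angle (s / τ)) ^ 2) *
        (√W / ε))) s := by
    convert! ((ha.cos.const_mul 2).mul ha.sin).mul_const (√W / ε) using 1
    ring
  unfold psiMinus kMinus psiMinusDeriv
  convert! ((ha.sin.neg.ofReal_comp.smul_const (outputState S n m false (r x))).add
    (ha.cos.ofReal_comp.smul_const (outputState S n m true (t x)))).add
    (hb.ofReal_comp.smul_const (queryState D x.1 (v x))) using 1
  rw [smul_add, smul_add, smul_smul, smul_smul, smul_smul]
  push_cast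
  congr 3 <;> ring

theorem norm_psiMinusDeriv_le (hr : ∀ x, ‖r x‖ = 1) (ht : ∀ x, ‖t x‖ = 1) (hW : 0 < W)
    (hε : 0 < ε) (hv : ∀ x, ∑ i, ‖v x i‖ ^ 2 ≤ W) (x : X) (s : ℝ) :
    ‖psiMinusDeriv W ε r t v x s‖ ≤ 1 + 2 * W / ε := by
  refine (norm_add_le _ _).trans (add_le_add ?_ ?_)
  · refine le_of_sq_le_sq ?_ zero_le_one
    rw [@norm_add_sq ℂ]
    simp only [inner_smul_left, inner_smul_right, inner_outputState, norm_smul, norm_outputState,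
      hr, ht, Complex.norm_real, Real.norm_eq_abs, abs_neg, sq_abs, mul_one, Bool.false_eq_true,
      if_false, mul_zero, map_zero, add_zero]
    rw [Real.cos_sq_add_sin_sq, one_pow]
  · have hq : ‖queryState D x.1 (v x)‖ ≤ √W := by
      refine Real.le_sqrt_of_sq_le ?_
      rw [norm_sq_queryState]
      exact hv x
    rw [norm_smul, Complex.norm_real, Real.norm_eq_abs, abs_mul, abs_mul, abs_two,
      abs_of_pos (div_pos (Real.sqrt_pos.2 hW) hε)]
    have hc : |Real.cos (angle s) ^ 2 - Real.sin (angle s) ^ 2| ≤ 1 := by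
      rw [← Real.cos_two_mul', abs_le]
      exact ⟨Real.neg_one_le_cos _, Real.cos_le_one _⟩
    calc 2 * |Real.cos (angle s) ^ 2 - Real.sin (angle s) ^ 2| * (√W / ε) *
        ‖queryState D x.1 (v x)‖ ≤ 2 * 1 * (√W / ε) * √W := by gcongr
      _ = 2 * (√W * √W) / ε := by ring
      _ = 2 * W / ε := by rw [Real.mul_self_sqrt hW.le]

/-- At both ends of the schedule the approximate solution is close to an output state. -/
theorem norm_smul_plusQueryState_add_le (hW : 0 < W) (hε : 0 < ε)
    (hu : ∀ x, ∑ i, ‖u x i‖ ^ 2 ≤ W) (x : X) (b : Bool) {w : EuclideanSpace ℂ D} (hw : ‖w‖ = 1)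
    {z : ℂ} {c : ℝ} (hz : ‖z‖ = c) :
    ‖((ε / √W : ℝ) : ℂ) • plusQueryState D x.1 (u x) + z • outputState S n m b w‖ ≤
      √(ε ^ 2 + c ^ 2) := by
  refine Real.le_sqrt_of_sq_le ?_
  rw [@norm_add_sq ℂ, plusQueryState]
  simp only [inner_smul_left, inner_smul_right, inner_registerState_outputState, mul_zero, map_zero,
    add_zero, norm_smul, norm_outputState, hw, hz, mul_one, mul_pow]
  rw [← plusQueryState, norm_sq_plusQueryState, Complex.norm_real, Real.norm_eq_abs, sq_abs, div_pow,
    Real.sq_sqrt hW.le]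
  gcongr
  calc ε ^ 2 / W * ∑ i, ‖u x i‖ ^ 2 ≤ ε ^ 2 / W * W := by gcongr; exact hu x
    _ = ε ^ 2 := by field_simp

theorem adiaConvert_convertsStates (hρ : IsGram ρ) (hσ : IsGram σ) (hr : HasGram r ρ)
    (ht : HasGram t σ) (h : IsWitness (ρ - σ) (filterMatrix X) W u v) (hε : 0 < ε)
    (hε1 : 9 * ε ^ 2 ≤ 1) (hWε : ε / 2 ≤ W) :
    (adiaConvert W ε r t v).ConvertsStates (fun x => outputState S n m false (r x))
      (fun x => outputState S n m true (t x)) (9 * ε ^ 2) := by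
  intro x
  have hW : 0 < W := by linarith
  have hr1 := hr.norm_eq_one hρ
  have ht1 := ht.norm_eq_one hσ
  set τ := 15 * W / ε ^ 2 with hτ
  have hτ0 : 0 < τ := by positivity
  set c := Real.pi / (2 * τ) with hc
  have hc0 : 0 < c := by positivity
  have hmeas : StronglyMeasurable fun s => adiaHamiltonian W ε r t v x (s / τ) := by
    refine StronglyMeasurable.sub ?_ stronglyMeasurable_const
    exact (stronglyMeasurable_adiaDriver W ε r t v).comp_measurable (measurable_id.div_const _)
  obtain ⟨φ, hφc, hφ0, hφ⟩ := exists_schroedinger_solution hmeas zero_lt_two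
    (fun s => norm_adiaHamiltonian_le x _) hτ0.le (outputState S n m false (r x))
  have hφ' : ∀ s ∈ Set.Icc 0 τ, φ s =
      φ 0 - Complex.I • ∫ a in (0 : ℝ)..s, adiaHamiltonian W ε r t v x (a / τ) (φ a) := by
    rw [hφ0]; exact hφ
  -- A zero source term in the stability estimate gives conservation of the norm.
  have hnorm : ‖φ τ‖ = 1 := by
    have := abs_norm_sub_norm_le_of_schroedinger hmeas (fun s => adiaHamiltonian_isSelfAdjoint x _)
      zero_le_two (fun s => norm_adiaHamiltonian_le x _) hτ0.le le_rfl hφc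
      (g := fun _ => 0) continuousOn_const (fun _ _ => by simp) (fun s hs => by
        rw [intervalIntegral.integral_zero, sub_zero]; exact hφ' s hs)
    rw [zero_mul, abs_nonpos_iff, sub_eq_zero, hφ0, norm_outputState, hr1] at this
    exact this
  have hdc : Continuous (psiMinusDeriv W ε r t v x) := by
    have := continuous_angle
    unfold psiMinusDeriv
    fun_prop
  have hmain := norm_sub_le_of_zero_mode hmeas (fun s => adiaHamiltonian_isSelfAdjoint x _)
    zero_le_two (fun s => norm_adiaHamiltonian_le x _) hτ0.le (G := c * (c * (1 + 2 * W / ε)))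
    (by positivity) hφc hφ'
    (p := fun s => psiPlus W ε r t u x (s / τ))
    (q := fun s => (c : ℂ) • psiMinus W ε r t v x (s / τ))
    (q' := fun s => (c : ℂ) • (c : ℂ) • psiMinusDeriv W ε r t v x (s / τ))
    (fun s => by
      rw [map_smul, adiaHamiltonian_psiMinus]
      exact hasDerivAt_psiPlus τ x s)
    (fun s => adiaHamiltonian_psiPlus hr ht h hW hε x _)
    (fun s => (hasDerivAt_psiMinus τ x s).const_smul (c : ℂ))
    (by fun_prop)
    (fun s => by
      rw [norm_smul, norm_smul, Complex.norm_real, Real.norm_eq_abs, abs_of_pos hc0]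
      have := norm_psiMinusDeriv_le hr1 ht1 hW hε h.right_le x (s / τ)
      gcongr)
  have hcε : c ≤ 0.2096 * ε := by
    have hpi : Real.pi ≤ 3.142 := by linarith [Real.pi_lt_d4]
    rw [hc, hτ, div_le_iff₀ (by positivity)]
    have : 0.2096 * ε * (2 * (15 * W / ε ^ 2)) = 6.288 * W / ε := by field_simp; ring
    rw [this, le_div_iff₀ hε]
    nlinarith
  have hend : √(ε ^ 2 + c ^ 2) ≤ 1.03 * ε := by
    rw [Real.sqrt_le_iff]
    refine ⟨by positivity, ?_⟩
    have : c ^ 2 ≤ (0.2096 * ε) ^ 2 := by gcongr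
    nlinarith [sq_nonneg ε]
  have hGT : c * (c * (1 + 2 * W / ε)) * τ ≤ 0.7 * ε := by
    have h1 : c * τ = Real.pi / 2 := by rw [hc]; field_simp
    have h2 : c * (c * (1 + 2 * W / ε)) * τ = (c * τ) * (c * (1 + 2 * W / ε)) := by ring
    have h3 : c * (1 + 2 * W / ε) ≤ 0.4192 * ε := by
      have h4 : c * (1 + 2 * W / ε) = c + 2 * (c * W) / ε := by ring
      have h5 : c * W = Real.pi * ε ^ 2 / 30 := by rw [hc, hτ]; field_simp; ring
      have h6 : 2 * (c * W) / ε = Real.pi * ε / 15 := by rw [h5]; field_simp; ring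
      rw [h4, h6]
      nlinarith [Real.pi_lt_d4]
    rw [h2, h1]
    have hpi : Real.pi ≤ 3.1416 := by linarith [Real.pi_lt_d4]
    calc Real.pi / 2 * (c * (1 + 2 * W / ε)) ≤ 3.1416 / 2 * (0.4192 * ε) := by
          have := Real.pi_pos
          gcongr
      _ ≤ 0.7 * ε := by linarith
  have hIc : ‖-(Complex.I * (c : ℂ))‖ = c := by
    rw [norm_neg, norm_mul, Complex.norm_I, one_mul, Complex.norm_real, Real.norm_eq_abs,
      abs_of_pos hc0]
  have hIc' : ‖Complex.I * (c : ℂ)‖ = c := by rw [← norm_neg, hIc]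
  have hstart : ‖φ 0 - (psiPlus W ε r t u x (0 / τ) +
      Complex.I • (c : ℂ) • psiMinus W ε r t v x (0 / τ))‖ ≤ 1.03 * ε := by
    refine le_trans (le_of_eq ?_) ((norm_smul_plusQueryState_add_le hW hε h.left_le x true
      (ht1 x) hIc').trans hend)
    rw [← norm_neg, hφ0]
    simp only [psiPlus, psiMinus, kMinus, angle, zero_div, mul_zero, Real.cos_zero, Real.sin_zero,
      neg_zero, Complex.ofReal_zero, Complex.ofReal_one, zero_smul, one_smul, zero_add, zero_mul,
      add_zero, smul_smul]
    congr 1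
    abel
  have hfinish : ‖psiPlus W ε r t u x (τ / τ) +
      Complex.I • (c : ℂ) • psiMinus W ε r t v x (τ / τ) - outputState S n m true (t x)‖ ≤
      1.03 * ε := by
    refine le_trans (le_of_eq ?_) ((norm_smul_plusQueryState_add_le hW hε h.left_le x false
      (hr1 x) hIc).trans hend)
    simp only [psiPlus, psiMinus, kMinus, angle, div_self hτ0.ne', mul_one, Real.cos_pi_div_two,
      Real.sin_pi_div_two, Complex.ofReal_zero, Complex.ofReal_one, zero_smul, one_smul, zero_add,
      zero_mul, mul_zero, add_zero, smul_smul, Complex.ofReal_neg, mul_neg]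
    congr 1
    abel
  have hdist : ‖φ τ - outputState S n m true (t x)‖ ≤ 3 * ε := by
    have := norm_sub_le_norm_sub_add_norm_sub (φ τ) (psiPlus W ε r t u x (τ / τ) +
      Complex.I • (c : ℂ) • psiMinus W ε r t v x (τ / τ)) (outputState S n m true (t x))
    linarith
  refine ⟨φ, ⟨hφc, fun s hs => ?_⟩, hφ0, ?_⟩
  · refine (hφ' s hs).trans ?_
    congr 3
    funext a
    change _ = (adiaDriver W ε r t v (a / τ) +
      ((-1 : ℝ) : ℂ) • oracleProjection D m x.1) (φ a)
    rw [clm_add_neg_one_smul, adiaHamiltonian]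
  · refine sqrt_le_re_inner_of_norm_sub ?_ hnorm hε1 ?_
    · rw [norm_outputState, ht1]
    · calc ‖φ τ - outputState S n m true (t x)‖ ^ 2 ≤ (3 * ε) ^ 2 := by gcongr
        _ = 9 * ε ^ 2 := by ring

end AdiaConvert

/-! ### Optimal witnesses of the adversary bound -/

section Attained

variable {X Y : Type*} {n : ℕ} {A : Matrix X Y ℂ} {Z : Fin n → Matrix X Y ℂ}

/-- A space of dimension at most `N` embeds isometrically in `ℂ^N`. -/
theorem exists_linearMap_inner_eq {V : Type*} [NormedAddCommGroup V] [InnerProductSpace ℂ V]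
    [FiniteDimensional ℂ V] {N : ℕ} (hN : Module.finrank ℂ V ≤ N) :
    ∃ f : V → EuclideanSpace ℂ (Fin N), ∀ a b, inner ℂ (f a) (f b) = inner ℂ a b := by
  let b := stdOrthonormalBasis ℂ V
  have ho : Orthonormal ℂ fun i => EuclideanSpace.basisFun (Fin N) ℂ (Fin.castLE hN i) :=
    (EuclideanSpace.basisFun (Fin N) ℂ).orthonormal.comp _ (Fin.castLE_injective hN)
  refine ⟨fun a => ∑ i, inner ℂ (b i) a • EuclideanSpace.basisFun (Fin N) ℂ (Fin.castLE hN i),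
    fun x y => ?_⟩
  rw [ho.inner_sum, ← b.sum_inner_mul_inner x y]
  simp only [inner_conj_symm]

/-- The dimension of the vectors of a feasible point can be bounded: project the `u`s on the span
of the `v`s. -/
theorem IsWitness.exists_of_card_le [Fintype Y] {m N : ℕ} {c : ℝ}
    {u : X → Fin n → EuclideanSpace ℂ (Fin m)} {v : Y → Fin n → EuclideanSpace ℂ (Fin m)}
    (h : IsWitness A Z c u v) (hN : Fintype.card (Y × Fin n) ≤ N) :
    ∃ (u' : X → Fin n → EuclideanSpace ℂ (Fin N)) (v' : Y → Fin n → EuclideanSpace ℂ (Fin N)),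
      IsWitness A Z c u' v' := by
  let V : Submodule ℂ (EuclideanSpace ℂ (Fin m)) :=
    Submodule.span ℂ (Set.range fun p : Y × Fin n => v p.1 p.2)
  have hv : ∀ y j, v y j ∈ V := fun y j => Submodule.subset_span ⟨(y, j), rfl⟩
  obtain ⟨f, hf⟩ := exists_linearMap_inner_eq (V := V)
    ((finrank_range_le_card (R := ℂ) fun p : Y × Fin n => v p.1 p.2).trans hN)
  have hfn : ∀ a, ‖f a‖ = ‖a‖ := fun a => by
    rw [@norm_eq_sqrt_re_inner ℂ, hf]
    exact (@norm_eq_sqrt_re_inner ℂ _ _ _ _ a).symm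
  refine ⟨fun x j => f (V.orthogonalProjectionOnto (u x j)), fun y j => f ⟨v y j, hv y j⟩,
    h.nonneg, fun x => ?_, fun y => ?_, fun x y => ?_⟩
  · refine le_trans ?_ (h.left_le x)
    gcongr with j
    rw [hfn]
    exact V.norm_orthogonalProjectionOnto_apply_le _
  · simp only [hfn]
    exact h.right_le y
  · rw [h.eq x y]
    refine Finset.sum_congr rfl fun j _ => ?_
    rw [hf]
    congr 1
    exact (Submodule.inner_orthogonalProjectionOnto_eq_of_mem_right ⟨v y j, hv y j⟩ (u x j)).symm

/-- The infimum defining the filtered `γ₂` norm is attained as soon as the problem is feasible. -/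
theorem exists_isWitness_filteredGamma2 [Fintype X] [Fintype Y]
    (hfeas : ∃ (c : ℝ) (m : ℕ) (u : X → Fin n → EuclideanSpace ℂ (Fin m))
      (v : Y → Fin n → EuclideanSpace ℂ (Fin m)), IsWitness A Z c u v) :
    ∃ (m : ℕ) (u : X → Fin n → EuclideanSpace ℂ (Fin m))
      (v : Y → Fin n → EuclideanSpace ℂ (Fin m)), IsWitness A Z (filteredGamma2 A Z) u v := by
  set N := Fintype.card (Y × Fin n) with hN
  obtain ⟨c₁, m₁, u₁, v₁, h₁⟩ := hfeas
  obtain ⟨u₁, v₁, h₁⟩ := h₁.exists_of_card_le (N := N) le_rfl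
  let K : Set (ℝ × (X → Fin n → EuclideanSpace ℂ (Fin N)) ×
      (Y → Fin n → EuclideanSpace ℂ (Fin N))) :=
    {p | p.1 ≤ c₁ ∧ IsWitness A Z p.1 p.2.1 p.2.2}
  have hclosed : IsClosed K := by
    have : K = {p | p.1 ≤ c₁} ∩ {p | 0 ≤ p.1} ∩ (⋂ x, {p | ∑ j, ‖p.2.1 x j‖ ^ 2 ≤ p.1}) ∩
        (⋂ y, {p | ∑ j, ‖p.2.2 y j‖ ^ 2 ≤ p.1}) ∩
        (⋂ x, ⋂ y, {p | A x y = ∑ j, Z j x y * inner ℂ (p.2.1 x j) (p.2.2 y j)}) := by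
      ext p
      simp only [Set.mem_inter_iff, Set.mem_iInter, Set.mem_ofPred_eq, K]
      exact ⟨fun ⟨h, h'⟩ => ⟨⟨⟨⟨h, h'.nonneg⟩, h'.left_le⟩, h'.right_le⟩, h'.eq⟩,
        fun ⟨⟨⟨⟨h, h1⟩, h2⟩, h3⟩, h4⟩ => ⟨h, h1, h2, h3, h4⟩⟩
    rw [this]
    refine ((((isClosed_le (by fun_prop) (by fun_prop)).inter
      (isClosed_le (by fun_prop) (by fun_prop))).inter
      (isClosed_iInter fun x => isClosed_le (by fun_prop) (by fun_prop))).inter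
      (isClosed_iInter fun y => isClosed_le (by fun_prop) (by fun_prop))).inter
      (isClosed_iInter fun x => isClosed_iInter fun y => isClosed_eq (by fun_prop) ?_)
    exact continuous_finsetSum _ fun j _ => continuous_const.mul
      (Continuous.inner (by fun_prop) (by fun_prop))
  have hbdd : Bornology.IsBounded K := by
    refine Bornology.IsBounded.subset (Metric.isBounded_closedBall (x := 0) (r := c₁ + √c₁)) ?_
    rintro ⟨c, u, v⟩ ⟨hc, hw⟩
    have hc0 := hw.nonneg
    simp only at hc hc0 hw
    have hc1 : 0 ≤ c₁ := hc0.trans hc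
    have hr : 0 ≤ c₁ + √c₁ := by positivity
    have hle : √c₁ ≤ c₁ + √c₁ := by linarith
    rw [mem_closedBall_zero_iff, Prod.norm_mk, Prod.norm_mk, max_le_iff, max_le_iff,
      pi_norm_le_iff_of_nonneg hr, pi_norm_le_iff_of_nonneg hr]
    refine ⟨?_, fun x => (pi_norm_le_iff_of_nonneg hr).2 fun j => ?_,
      fun y => (pi_norm_le_iff_of_nonneg hr).2 fun j => ?_⟩
    · rw [Real.norm_eq_abs, abs_of_nonneg hc0]
      linarith [Real.sqrt_nonneg c₁]
    · refine le_trans (Real.le_sqrt_of_sq_le (le_trans ?_ ((hw.left_le x).trans hc))) hle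
      exact Finset.single_le_sum (f := fun j => ‖u x j‖ ^ 2) (fun _ _ => sq_nonneg _)
        (Finset.mem_univ j)
    · refine le_trans (Real.le_sqrt_of_sq_le (le_trans ?_ ((hw.right_le y).trans hc))) hle
      exact Finset.single_le_sum (f := fun j => ‖v y j‖ ^ 2) (fun _ _ => sq_nonneg _)
        (Finset.mem_univ j)
  have hcomp : IsCompact K := Metric.isCompact_of_isClosed_isBounded hclosed hbdd
  obtain ⟨⟨c, u, v⟩, ⟨hc, hw⟩, hmin⟩ := hcomp.exists_isMinOn ⟨(c₁, u₁, v₁), le_rfl, h₁⟩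
    (f := Prod.fst) continuous_fst.continuousOn
  have hleast : IsLeast {c : ℝ | ∃ (m : ℕ) (u : X → Fin n → EuclideanSpace ℂ (Fin m))
      (v : Y → Fin n → EuclideanSpace ℂ (Fin m)), IsWitness A Z c u v} c := by
    refine ⟨⟨N, u, v, hw⟩, ?_⟩
    rintro c' ⟨m', u', v', h'⟩
    by_cases hc' : c' ≤ c₁
    · obtain ⟨u', v', h'⟩ := h'.exists_of_card_le (N := N) le_rfl
      exact hmin (show (c', u', v') ∈ K from ⟨hc', h'⟩)
    · exact hc.trans (not_le.1 hc').le
  rw [filteredGamma2, hleast.csInf_eq]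
  exact ⟨N, u, v, hw⟩

/-- Feasibility for a matrix with zero diagonal: take `v_{y,j} = |y⟩` and spread the row `x` of the
matrix over the positions where `x` and `y` differ. -/
theorem exists_isWitness_filterMatrix {S : Type u} [DecidableEq S] {X : Finset (Fin n → S)}
    {A : Matrix X X ℂ} (hA : ∀ x, A x x = 0) :
    ∃ (c : ℝ) (m : ℕ) (u v : X → Fin n → EuclideanSpace ℂ (Fin m)),
      IsWitness A (filterMatrix X) c u v := by
  let e := Fintype.equivFin X
  let k : X → X → ℂ := fun x y => ∑ j, filterMatrix X j x y
  have hk : ∀ x y, x ≠ y → k x y ≠ 0 := by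
    intro x y hxy h
    have hnat : k x y =
        ((∑ j, if x.1 j = y.1 j then 0 else 1 : ℕ) : ℂ) := by
      simp [k, filterMatrix, Matrix.of_apply]
    rw [hnat, Nat.cast_eq_zero, Finset.sum_eq_zero_iff] at h
    refine hxy (Subtype.ext (funext fun j => ?_))
    have := h j (Finset.mem_univ j)
    by_contra hne
    simp [hne] at this
  let u : X → Fin n → EuclideanSpace ℂ (Fin (Fintype.card X)) := fun x _ =>
    WithLp.toLp 2 fun i => star (A x (e.symm i) / k x (e.symm i))
  let v : X → Fin n → EuclideanSpace ℂ (Fin (Fintype.card X)) := fun y _ =>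
    EuclideanSpace.single (e y) 1
  have hu0 : ∀ x, 0 ≤ ∑ j, ‖u x j‖ ^ 2 := fun x => Finset.sum_nonneg fun _ _ => sq_nonneg _
  have hv0 : ∀ x, 0 ≤ ∑ j, ‖v x j‖ ^ 2 := fun x => Finset.sum_nonneg fun _ _ => sq_nonneg _
  have hu1 : 0 ≤ ∑ x, ∑ j, ‖u x j‖ ^ 2 := Finset.sum_nonneg fun x _ => hu0 x
  have hv1 : 0 ≤ ∑ x, ∑ j, ‖v x j‖ ^ 2 := Finset.sum_nonneg fun x _ => hv0 x
  refine ⟨(∑ x, ∑ j, ‖u x j‖ ^ 2) + ∑ y, ∑ j, ‖v y j‖ ^ 2, Fintype.card X, u, v, by linarith,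
    fun x => ?_, fun y => ?_, fun x y => ?_⟩
  · have := Finset.single_le_sum (f := fun x => ∑ j, ‖u x j‖ ^ 2) (fun x _ => hu0 x)
      (Finset.mem_univ x)
    linarith
  · have := Finset.single_le_sum (f := fun x => ∑ j, ‖v x j‖ ^ 2) (fun x _ => hv0 x)
      (Finset.mem_univ y)
    linarith
  · have hin : ∀ j, inner ℂ (u x j) (v y j) = A x y / k x y := fun j => by
      simp [u, v, EuclideanSpace.inner_single_right]
    simp only [hin]
    rw [← Finset.sum_mul]
    change A x y = k x y * (A x y / k x y)
    by_cases hxy : x = y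
    · subst hxy
      simp [hA]
    · rw [mul_div_cancel₀ _ (hk x y hxy)]

theorem exists_isWitness_advStar {S : Type u} [DecidableEq S] {X : Finset (Fin n → S)}
    {ρ σ : Matrix X X ℂ} (hρ : IsGram ρ) (hσ : IsGram σ) :
    ∃ (m : ℕ) (u v : X → Fin n → EuclideanSpace ℂ (Fin m)),
      IsWitness (ρ - σ) (filterMatrix X) (advStar ρ σ) u v :=
  exists_isWitness_filteredGamma2 (exists_isWitness_filterMatrix fun x => by
    rw [Matrix.sub_apply, hρ.2, hσ.2, sub_self])

end Attained

/-! ### The Powers–Størmer inequality -/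

section PowersStormer

variable {ι : Type*} [Fintype ι] [DecidableEq ι]

open scoped MatrixOrder in
theorem exists_posSemidef_mul_self {A : Matrix ι ι ℂ} (hA : A.PosSemidef) :
    ∃ R : Matrix ι ι ℂ, R.PosSemidef ∧ R * R = A :=
  ⟨CFC.sqrt A, Matrix.nonneg_iff_posSemidef.1 (CFC.sqrt_nonneg A),
    CFC.sqrt_mul_sqrt_self A (Matrix.nonneg_iff_posSemidef.2 hA)⟩

/-- The Powers–Størmer inequality `‖R - T‖₂² ≤ ‖R² - T²‖₁`, with the trace norm bounded through a
decomposition `R² - T² = P - N` into positive semidefinite parts. It is read off entrywise in a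
basis that diagonalizes `R - T`. -/
theorem powers_stormer {R T P N : Matrix ι ι ℂ} (hR : R.PosSemidef) (hT : T.PosSemidef)
    (hP : P.PosSemidef) (hN : N.PosSemidef) (h : R * R - T * T = P - N) :
    (R * R).trace.re + (T * T).trace.re - 2 * (T * R).trace.re ≤ P.trace.re + N.trace.re := by
  have hD : (R - T).IsHermitian := hR.1.sub hT.1
  let U : Matrix ι ι ℂ := hD.eigenvectorUnitary
  have hUU : U * Uᴴ = 1 := Unitary.coe_mul_star_self hD.eigenvectorUnitary
  let c : Matrix ι ι ℂ → Matrix ι ι ℂ := fun M => Uᴴ * M * U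
  have hcmul : ∀ A B, c (A * B) = c A * c B := by
    intro A B
    calc Uᴴ * (A * B) * U = Uᴴ * A * 1 * B * U := by simp only [Matrix.mul_one, Matrix.mul_assoc]
      _ = Uᴴ * A * (U * Uᴴ) * B * U := by rw [hUU]
      _ = _ := by simp only [c, Matrix.mul_assoc]
  have hcsub : ∀ A B, c (A - B) = c A - c B := by
    intro A B; simp only [c, Matrix.mul_sub, Matrix.sub_mul]
  have hctr : ∀ A, (c A).trace = A.trace := by
    intro A
    simp only [c]
    rw [Matrix.trace_mul_comm, ← Matrix.mul_assoc, hUU, Matrix.one_mul]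
  have hcpos : ∀ {A : Matrix ι ι ℂ}, A.PosSemidef → ∀ i, 0 ≤ (c A i i).re := fun hA i =>
    (Complex.nonneg_iff.1 ((hA.conjTranspose_mul_mul_same U).diag_nonneg (i := i))).1
  let d : ι → ℝ := hD.eigenvalues
  have hcD : c (R - T) = Matrix.diagonal fun i => (d i : ℂ) := by
    have := hD.conjStarAlgAut_star_eigenvectorUnitary
    rw [Unitary.conjStarAlgAut_star_apply] at this
    exact this
  have hdi : ∀ i, d i = (c R i i).re - (c T i i).re := by
    intro i
    have := congrArg (fun M : Matrix ι ι ℂ => (M i i).re) ((hcsub R T).symm.trans hcD)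
    simpa using this.symm
  have hRT : c R = c T + Matrix.diagonal fun i => (d i : ℂ) := by
    rw [← hcD, hcsub]; abel
  have hdiag : ∀ i, d i * (2 * (c T i i).re + d i) = (c P i i).re - (c N i i).re := by
    intro i
    have h1 : c R * c R - c T * c T = c P - c N := by
      rw [← hcmul, ← hcmul, ← hcsub, ← hcsub, h]
    have h2 := congrArg (fun M : Matrix ι ι ℂ => (M i i).re) h1
    rw [hRT, add_mul, mul_add, mul_add, Matrix.diagonal_mul_diagonal] at h2
    simp only [Matrix.sub_apply, Matrix.add_apply, Matrix.mul_diagonal, Matrix.diagonal_mul,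
      Matrix.diagonal_apply_eq, Complex.sub_re, Complex.add_re, Complex.mul_re, Complex.ofReal_re,
      Complex.ofReal_im] at h2
    linarith
  have hle : ∀ i, d i ^ 2 ≤ (c P i i).re + (c N i i).re := by
    intro i
    have h1 := hcpos hR i
    have h2 := hcpos hT i
    have h3 := hcpos hP i
    have h4 := hcpos hN i
    have h5 := hdi i
    have h6 := hdiag i
    rcases le_total 0 (d i) with h0 | h0
    · nlinarith
    · nlinarith
  have htr : (R * R).trace.re + (T * T).trace.re - 2 * (T * R).trace.re = ∑ i, d i ^ 2 := by
    have h1 : ((R - T) * (R - T)).trace = ∑ i, (d i : ℂ) ^ 2 := by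
      rw [← hctr, hcmul, hcD, Matrix.diagonal_mul_diagonal, Matrix.trace_diagonal]
      simp only [sq]
    have h2 : ((R - T) * (R - T)).trace = (R * R).trace + (T * T).trace - 2 * (T * R).trace := by
      rw [sub_mul, mul_sub, mul_sub, Matrix.trace_sub, Matrix.trace_sub, Matrix.trace_sub,
        Matrix.trace_mul_comm R T]
      ring
    have h3 := congrArg Complex.re (h2.symm.trans h1)
    have h4 : (∑ i, (d i : ℂ) ^ 2) = ((∑ i, d i ^ 2 : ℝ) : ℂ) := by push_cast; rfl
    rw [h4, Complex.ofReal_re] at h3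
    simpa using h3
  rw [htr, ← hctr P, ← hctr N, Matrix.trace, Matrix.trace, Complex.re_sum, Complex.re_sum,
    ← Finset.sum_add_distrib]
  exact Finset.sum_le_sum fun i _ => hle i

end PowersStormer

/-! ### Overlaps of realizations of two Gram matrices -/

section Overlap

variable {X : Type u} [Fintype X] [DecidableEq X]

theorem inner_column {R : Matrix X X ℂ} (T : Matrix X X ℂ) (hR : R.IsHermitian) (x y : X) :
    inner ℂ (WithLp.toLp 2 fun z => R z x : EuclideanSpace ℂ X)
      (WithLp.toLp 2 fun z => T z y : EuclideanSpace ℂ X) = (R * T) x y := by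
  rw [PiLp.inner_apply, Matrix.mul_apply]
  refine Finset.sum_congr rfl fun z _ => ?_
  rw [← hR.apply x z]
  simp [mul_comm]

theorem exists_hasGram {ρ : Matrix X X ℂ} (hρ : ρ.PosSemidef) :
    ∃ r : X → EuclideanSpace ℂ X, HasGram r ρ := by
  obtain ⟨R, hR, rfl⟩ := exists_posSemidef_mul_self hρ
  exact ⟨fun x => WithLp.toLp 2 fun z => R z x, fun x y => inner_column R hR.1 x y⟩

/-- `k x` is at most the overlap of `t x` and `r x` for all `x`, for some realizations `r` and `t`
of the Gram matrices `ρ` and `σ` in a common space. -/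
def OverlapAchievable (ρ σ : Matrix X X ℂ) (k : X → ℝ) : Prop :=
  ∃ (O : Type u) (_ : Fintype O) (r t : X → EuclideanSpace ℂ O),
    HasGram r ρ ∧ HasGram t σ ∧ ∀ x, k x ≤ (inner ℂ (t x) (r x)).re

/-- Convexity of the achievable overlaps, by direct sums. -/
theorem convex_overlapAchievable (ρ σ : Matrix X X ℂ) :
    Convex ℝ {k | OverlapAchievable ρ σ k} := by
  rintro k₁ ⟨O₁, _, r₁, t₁, hr₁, ht₁, hk₁⟩ k₂ ⟨O₂, _, r₂, t₂, hr₂, ht₂, hk₂⟩ a b ha hb hab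
  let S : EuclideanSpace ℂ O₁ → EuclideanSpace ℂ O₂ → EuclideanSpace ℂ (O₁ ⊕ O₂) := fun v w =>
    WithLp.toLp 2 (Sum.elim (fun i => ((√a : ℝ) : ℂ) * v i) (fun i => ((√b : ℝ) : ℂ) * w i))
  have hS : ∀ v w v' w', inner ℂ (S v w) (S v' w') = a * inner ℂ v v' + b * inner ℂ w w' := by
    intro v w v' w'
    have ha' : ((√a : ℝ) : ℂ) * ((√a : ℝ) : ℂ) = a := by
      rw [← Complex.ofReal_mul, Real.mul_self_sqrt ha]
    have hb' : ((√b : ℝ) : ℂ) * ((√b : ℝ) : ℂ) = b := by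
      rw [← Complex.ofReal_mul, Real.mul_self_sqrt hb]
    simp only [S, PiLp.inner_apply, Fintype.sum_sum_type, Sum.elim_inl, Sum.elim_inr, ← ha', ← hb',
      RCLike.inner_apply, map_mul, Complex.conj_ofReal, Finset.mul_sum]
    congr 1 <;> exact Finset.sum_congr rfl fun i _ => by ring
  have hab' : (a : ℂ) + b = 1 := by exact_mod_cast hab
  refine ⟨O₁ ⊕ O₂, inferInstance, fun x => S (r₁ x) (r₂ x), fun x => S (t₁ x) (t₂ x),
    fun x y => ?_, fun x y => ?_, fun x => ?_⟩
  · rw [hS, hr₁, hr₂, ← add_mul, hab', one_mul]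
  · rw [hS, ht₁, ht₂, ← add_mul, hab', one_mul]
  · rw [hS, Complex.add_re, Complex.re_ofReal_mul, Complex.re_ofReal_mul]
    have h1 := mul_le_mul_of_nonneg_left (hk₁ x) ha
    have h2 := mul_le_mul_of_nonneg_left (hk₂ x) hb
    simpa using add_le_add h1 h2

/-- Minimax principle for the achievable overlaps: a bound on all positively weighted averages gives
a uniform bound. -/
theorem exists_overlap_gt_of_average {ρ σ : Matrix X X ℂ} (hρ : IsGram ρ) (hσ : IsGram σ) {c c' : ℝ}
    (hc : c' < c) (h : ∀ p : X → ℝ, (∀ x, 0 < p x) →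
      ∃ k, OverlapAchievable ρ σ k ∧ c * ∑ x, p x ≤ ∑ x, p x * k x) :
    ∃ k, OverlapAchievable ρ σ k ∧ ∀ x, c' < k x := by
  by_contra hcon
  push Not at hcon
  have hdisj : Disjoint {k : X → ℝ | ∀ x, c' < k x} {k | OverlapAchievable ρ σ k} := by
    rw [Set.disjoint_left]
    intro k hk hk'
    obtain ⟨x, hx⟩ := hcon k hk'
    exact absurd (hk x) (not_lt.2 hx)
  have hconv : Convex ℝ {k : X → ℝ | ∀ x, c' < k x} := by
    have : {k : X → ℝ | ∀ x, c' < k x} = Set.univ.pi fun _ => Set.Ioi c' := by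
      ext k; simp
    rw [this]
    exact convex_pi fun x _ => convex_Ioi c'
  have hopen : IsOpen {k : X → ℝ | ∀ x, c' < k x} := by
    simp only [Set.ofPred_forall]
    exact isOpen_iInter_of_finite fun x => isOpen_lt continuous_const (continuous_apply x)
  obtain ⟨f, s, hfU, hfA⟩ := geometric_hahn_banach_open hconv hopen
    (convex_overlapAchievable ρ σ) hdisj
  have hf : ∀ k : X → ℝ, f k = -∑ x, -f (Pi.single x 1) * k x := by
    intro k
    have h1 : k = ∑ x, k x • (Pi.single x (1 : ℝ) : X → ℝ) := by
      ext y
      simp [Finset.sum_apply, Pi.single_apply]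
    conv_lhs => rw [h1]
    rw [map_sum, ← Finset.sum_neg_distrib]
    exact Finset.sum_congr rfl fun x _ => by rw [map_smul, smul_eq_mul]; ring
  set p : X → ℝ := fun x => -f (Pi.single x 1) with hp
  -- The separating functional is bounded above on an upper set, so its weights have a sign.
  have hp0 : ∀ x, 0 ≤ p x := by
    intro x
    by_contra hneg
    push Not at hneg
    set a := f (fun _ => c' + 1) with ha
    have hmem : ∀ l : ℝ, 0 ≤ l → a + l * (-p x) < s := by
      intro l hl
      have := hfU ((fun _ => c' + 1) + l • Pi.single x (1 : ℝ)) (fun y => by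
        have : 0 ≤ l * (Pi.single x (1 : ℝ) : X → ℝ) y := by
          refine mul_nonneg hl ?_
          rw [Pi.single_apply]
          split_ifs <;> norm_num
        simp only [Pi.add_apply, Pi.smul_apply, smul_eq_mul]
        linarith)
      rw [map_add, map_smul, smul_eq_mul] at this
      simpa [hp] using this
    have h1 := hmem 0 le_rfl
    have h2 := hmem ((s - a) / (-p x)) (div_nonneg (by linarith) (by linarith))
    rw [div_mul_cancel₀ _ (by linarith)] at h2
    linarith
  have hconst : -(c' * ∑ x, p x) ≤ s := by
    refine le_of_tendsto (f := fun e : ℝ => f fun _ => c' + e) (x := nhdsWithin 0 (Set.Ioi 0)) ?_ ?_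
    · have hcont : Continuous fun e : ℝ => f fun _ => c' + e := by fun_prop
      have := hcont.tendsto 0
      rw [hf] at this
      simp only [add_zero, ← Finset.sum_mul] at this
      rw [mul_comm]
      exact this.mono_left nhdsWithin_le_nhds
    · filter_upwards [self_mem_nhdsWithin] with e he
      exact (hfU _ fun x => by linarith [Set.mem_Ioi.1 he]).le
  have hupper : ∀ k, OverlapAchievable ρ σ k → ∑ x, p x * k x ≤ c' * ∑ x, p x := by
    intro k hk
    have := hfA k hk
    rw [hf] at this
    linarith
  have hle1 : ∀ k, OverlapAchievable ρ σ k → ∀ x, k x ≤ 1 := by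
    rintro k ⟨O, _, r, t, hr, ht, hk⟩ x
    refine (hk x).trans ((Complex.re_le_norm _).trans ((norm_inner_le_norm _ _).trans ?_))
    rw [hr.norm_eq_one hρ, ht.norm_eq_one hσ, one_mul]
  have hpert : ∀ e : ℝ, 0 < e →
      c * ∑ x, p x + e * (c - 1) * Fintype.card X ≤ c' * ∑ x, p x := by
    intro e he
    obtain ⟨k, hk, hle⟩ := h (fun x => p x + e) fun x => by linarith [hp0 x]
    have h1 := hupper k hk
    have h2 : ∑ x, k x ≤ Fintype.card X := by
      calc ∑ x, k x ≤ ∑ _x : X, (1 : ℝ) := Finset.sum_le_sum fun x _ => hle1 k hk x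
        _ = Fintype.card X := by simp
    simp only [add_mul, Finset.sum_add_distrib, Finset.sum_const, Finset.card_univ, nsmul_eq_mul,
      ← Finset.mul_sum, mul_add] at hle
    nlinarith
  have hsum : ∑ x, p x = 0 := by
    have h1 : c * ∑ x, p x ≤ c' * ∑ x, p x := by
      refine le_of_tendsto (f := fun e : ℝ => c * ∑ x, p x + e * (c - 1) * Fintype.card X)
        (x := nhdsWithin 0 (Set.Ioi 0)) ?_ ?_
      · have hcont : Continuous fun e : ℝ => c * ∑ x, p x + e * (c - 1) * Fintype.card X := by
          fun_prop
        have := hcont.tendsto 0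
        simp only [zero_mul, add_zero] at this
        exact this.mono_left nhdsWithin_le_nhds
      · filter_upwards [self_mem_nhdsWithin] with e he
        exact hpert e he
    have h2 : 0 ≤ ∑ x, p x := Finset.sum_nonneg fun x _ => hp0 x
    nlinarith
  have hpz : ∀ x, p x = 0 := fun x =>
    (Finset.sum_eq_zero_iff_of_nonneg fun x _ => hp0 x).1 hsum x (Finset.mem_univ x)
  have hfz : ∀ k, f k = 0 := fun k => by
    rw [hf k]
    change -∑ x, p x * k x = 0
    simp [hpz]
  obtain ⟨k, hk, -⟩ := h (fun _ => 1) fun _ => one_pos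
  have h1 := hfU (fun _ => c' + 1) fun _ => by linarith
  have h2 := hfA k hk
  rw [hfz] at h1 h2
  linarith

/-- If `ρ - σ` is a difference of Gram matrices of vectors with `‖P_x‖² + ‖N_x‖² ≤ 2 w`, all
weighted averages of the overlap can be made at least `1 - w`: realize the weighted matrices by the
columns of their square roots. -/
theorem exists_average_overlap {ρ σ : Matrix X X ℂ} (hρ : IsGram ρ) (hσ : IsGram σ) {E : Type*}
    [NormedAddCommGroup E] [InnerProductSpace ℂ E] {P N : X → E} {w : ℝ}
    (hPN : ∀ x y, ρ x y - σ x y = inner ℂ (P x) (P y) - inner ℂ (N x) (N y))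
    (hw : ∀ x, ‖P x‖ ^ 2 + ‖N x‖ ^ 2 ≤ 2 * w) (p : X → ℝ) (hp : ∀ x, 0 < p x) :
    ∃ k, OverlapAchievable ρ σ k ∧ (1 - w) * ∑ x, p x ≤ ∑ x, p x * k x := by
  let d : X → ℂ := fun x => ((√(p x) : ℝ) : ℂ)
  have hd0 : ∀ x, d x ≠ 0 := fun x => by
    simp only [d]
    exact_mod_cast (Real.sqrt_pos.2 (hp x)).ne'
  have hdd : ∀ x, d x * d x = p x := fun x => by
    simp only [d]
    rw [← Complex.ofReal_mul, Real.mul_self_sqrt (hp x).le]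
  have hdconj : ∀ x, (starRingEnd ℂ) (d x) = d x := fun x => Complex.conj_ofReal _
  let W : Matrix X X ℂ → Matrix X X ℂ := fun M => Matrix.of fun x y => d x * M x y * d y
  have hWpos : ∀ {M : Matrix X X ℂ}, M.PosSemidef → (W M).PosSemidef := by
    intro M hM
    have := hM.conjTranspose_mul_mul_same (Matrix.diagonal d)
    convert! this using 1
    ext x y
    simp [W, Matrix.diagonal_conjTranspose, Matrix.mul_diagonal, Matrix.diagonal_mul, hdconj]
  have hWtr : ∀ M : Matrix X X ℂ, (W M).trace.re = ∑ x, p x * (M x x).re := by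
    intro M
    rw [Matrix.trace, Complex.re_sum]
    refine Finset.sum_congr rfl fun x _ => ?_
    simp only [W, Matrix.diag_apply, Matrix.of_apply]
    rw [mul_right_comm, hdd, Complex.re_ofReal_mul]
  obtain ⟨R, hR, hRR⟩ := exists_posSemidef_mul_self (hWpos hρ.1)
  obtain ⟨T, hT, hTT⟩ := exists_posSemidef_mul_self (hWpos hσ.1)
  have hps := powers_stormer hR hT (hWpos (Matrix.posSemidef_gram ℂ P))
    (hWpos (Matrix.posSemidef_gram ℂ N)) (by
      rw [hRR, hTT]
      ext x y
      simp only [W, Matrix.sub_apply, Matrix.of_apply, Matrix.gram_apply]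
      rw [← sub_mul, ← mul_sub, hPN, mul_sub, sub_mul])
  rw [hRR, hTT, hWtr, hWtr, hWtr, hWtr] at hps
  simp only [hρ.2, hσ.2, Complex.one_re, mul_one, Matrix.gram_apply] at hps
  let r : X → EuclideanSpace ℂ X := fun x => (d x)⁻¹ • WithLp.toLp 2 fun z => R z x
  let t : X → EuclideanSpace ℂ X := fun x => (d x)⁻¹ • WithLp.toLp 2 fun z => T z x
  refine ⟨fun x => (inner ℂ (t x) (r x)).re, ⟨X, inferInstance, r, t, fun x y => ?_, fun x y => ?_,
    fun x => le_rfl⟩, ?_⟩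
  · simp only [r, inner_smul_left, inner_smul_right, map_inv₀, hdconj]
    rw [inner_column _ hR.1, hRR]
    simp only [W, Matrix.of_apply]
    field_simp [hd0]
  · simp only [t, inner_smul_left, inner_smul_right, map_inv₀, hdconj]
    rw [inner_column _ hT.1, hTT]
    simp only [W, Matrix.of_apply]
    field_simp [hd0]
  · have h1 : ∑ x, p x * (inner ℂ (t x) (r x)).re = (T * R).trace.re := by
      rw [Matrix.trace, Complex.re_sum]
      refine Finset.sum_congr rfl fun x _ => ?_
      rw [← Complex.re_ofReal_mul, ← hdd]
      simp only [t, r, inner_smul_left, inner_smul_right, map_inv₀, hdconj]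
      rw [inner_column _ hT.1, Matrix.diag_apply]
      congr 1
      field_simp [hd0]
    rw [h1]
    have h2 : ∑ x, p x * (inner ℂ (P x) (P x)).re + ∑ x, p x * (inner ℂ (N x) (N x)).re ≤
        2 * w * ∑ x, p x := by
      rw [← Finset.sum_add_distrib, Finset.mul_sum]
      refine Finset.sum_le_sum fun x _ => ?_
      have h3 := hw x
      rw [← @inner_self_eq_norm_sq ℂ, ← @inner_self_eq_norm_sq ℂ] at h3
      simp only [RCLike.re_to_complex] at h3
      nlinarith [hp x]
    linarith

end Overlap

/-! ### The algorithm of running time zero -/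

section Idle

variable {S : Type u} [DecidableEq S] {n m : ℕ} {X : Finset (Fin n → S)} {ρ σ : Matrix X X ℂ}

theorem isHermitian_conj_apply {A : Matrix X X ℂ} (hA : A.IsHermitian) (x y : X) :
    (starRingEnd ℂ) (A y x) = A x y := hA.apply x y

/-- The algorithm of running time zero. -/
def idleAlgorithm (S : Type u) (n : ℕ) (O : Type u) [Fintype O] : QueryAlgorithm S n where
  O := O
  M := PEmpty
  h := 0
  time := 0
  driver := 0
  coupling := 0

theorem isSelfAdjoint_clm_zero (E : Type*) [NormedAddCommGroup E] [InnerProductSpace ℂ E]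
    [CompleteSpace E] : IsSelfAdjoint (0 : E →L[ℂ] E) := IsSelfAdjoint.zero _

theorem idleAlgorithm_isValid (O : Type u) [Fintype O] : (idleAlgorithm S n O).IsValid where
  time_nonneg := le_rfl
  h_selfAdjoint _ := isSelfAdjoint_clm_zero _
  h_norm_le _ := by change ‖(0 : EuclideanSpace ℂ PEmpty →L[ℂ] EuclideanSpace ℂ PEmpty)‖ ≤ 1; simp
  driver_selfAdjoint _ _ := isSelfAdjoint_clm_zero _
  driver_integrable := IntervalIntegrable.refl
  coupling_le _ _ := by change |(0 : ℝ)| ≤ 1; simp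
  coupling_integrable := IntervalIntegrable.refl

theorem solvableInTime_zero_of_overlap {O : Type u} [Fintype O] {r t : X → EuclideanSpace ℂ O}
    (hr : HasGram r ρ) (ht : HasGram t σ) {ε : ℝ}
    (h : ∀ x, √(1 - ε) ≤ (inner ℂ (t x) (r x)).re) : SolvableInTime ρ σ ε 0 := by
  let e : EuclideanSpace ℂ O → StateSpace O PEmpty.{u + 1} n := fun w =>
    WithLp.toLp 2 (Sum.elim w fun _ => 0)
  have he : ∀ v w, inner ℂ (e v) (e w) = inner ℂ v w := fun v w => by
    simp [e, PiLp.inner_apply, Fintype.sum_sum_type]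
  refine ⟨idleAlgorithm S n O, idleAlgorithm_isValid O, rfl, fun x => e (r x), fun x => e (t x),
    fun x y => (he _ _).trans (hr x y), fun x y => (he _ _).trans (ht x y), fun x => ?_⟩
  refine ⟨fun _ => e (r x), ⟨continuousOn_const, fun s hs => ?_⟩, rfl, ?_⟩
  · have : s = 0 := le_antisymm hs.2 hs.1
    rw [this, intervalIntegral.integral_same, smul_zero]
    exact (sub_zero _).symm
  · exact (h x).trans_eq (congrArg Complex.re (he _ _).symm)

/-- A small adversary bound makes `ρ` and `σ` so close that no evolution is needed. -/
theorem solvableInTime_zero [Fintype S] (hρ : IsGram ρ) (hσ : IsGram σ) {ε : ℝ} (hε1 : ε ≤ 1)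
    (hW : advStar ρ σ < ε / 2) : SolvableInTime ρ σ ε 0 := by
  obtain ⟨m, u, v, h⟩ := exists_isWitness_advStar hρ hσ
  set W := advStar ρ σ
  let a : X → StateSpace (Bool × PUnit.{u + 1}) (Option S × Fin m) n :=
    fun x => plusQueryState PUnit x.1 (u x)
  let b : X → StateSpace (Bool × PUnit.{u + 1}) (Option S × Fin m) n :=
    fun x => queryState PUnit x.1 (v x)
  have hab : ∀ x y, inner ℂ (a x) (b y) = (ρ - σ) x y / 2 :=
    fun x y => inner_plusQueryState_queryState h x y
  have hba : ∀ x y, inner ℂ (b x) (a y) = (ρ - σ) x y / 2 := fun x y => by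
    rw [← inner_conj_symm, hab, map_div₀, Complex.conj_ofNat,
      isHermitian_conj_apply (hρ.1.1.sub hσ.1.1)]
  have ha : ∀ x, ‖a x‖ ^ 2 ≤ W := fun x => by
    rw [norm_sq_plusQueryState]; exact h.left_le x
  have hb : ∀ x, ‖b x‖ ^ 2 ≤ W := fun x => by
    rw [norm_sq_queryState]; exact h.right_le x
  let z : ℂ := ((1 / √2 : ℝ) : ℂ)
  have hz : z * z = 1 / 2 := inv_sqrt_two_mul_self
  have hzc : (starRingEnd ℂ) z = z := Complex.conj_ofReal _
  have hzn : ‖z‖ ^ 2 = 1 / 2 := by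
    rw [sq, ← norm_mul, hz]; norm_num
  obtain ⟨k, ⟨O, _, r, t, hr, ht, hk⟩, hk'⟩ := exists_overlap_gt_of_average hρ hσ
    (c := 1 - W) (c' := 1 - ε / 2) (by linarith)
    (exists_average_overlap hρ hσ (P := fun x => z • (a x + b x)) (N := fun x => z • (a x - b x))
      (fun x y => by
        simp only [inner_smul_left, inner_smul_right, inner_add_left, inner_add_right,
          inner_sub_left, inner_sub_right, hab, hba, hzc, Matrix.sub_apply]
        linear_combination (-2 * (ρ x y - σ x y)) * hz)
      (fun x => by
        rw [norm_smul, norm_smul, mul_pow, mul_pow, hzn]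
        have := parallelogram_law_with_norm ℂ (a x) (b x)
        nlinarith [ha x, hb x]))
  refine solvableInTime_zero_of_overlap hr ht fun x => ?_
  refine le_trans ?_ ((hk' x).le.trans (hk x))
  rw [Real.sqrt_le_iff]
  constructor
  · linarith
  · nlinarith [sq_nonneg ε]

end Idle

/-! ### Concatenation of time-dependent functions -/

section Concatenation

/-- The function that follows `f` up to time `T` and then `g`, shifted. -/
def concat {α : Type*} (T : ℝ) (f g : ℝ → α) (t : ℝ) : α := if t ≤ T then f t else g (t - T)

variable {F : Type*} [NormedAddCommGroup F] {T₁ T₂ : ℝ} {f g : ℝ → F}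

theorem intervalIntegrable_concat_left {t : ℝ} (ht0 : 0 ≤ t) (ht : t ≤ T₁)
    (hf : IntervalIntegrable f volume 0 t) : IntervalIntegrable (concat T₁ f g) volume 0 t := by
  refine hf.congr fun s hs => ?_
  rw [Set.uIoc_of_le ht0] at hs
  exact (if_pos (hs.2.trans ht)).symm

theorem intervalIntegrable_concat_right {t : ℝ} (ht : T₁ ≤ t)
    (hg : IntervalIntegrable g volume 0 (t - T₁)) :
    IntervalIntegrable (concat T₁ f g) volume T₁ t := by
  have h := hg.comp_sub_right T₁
  rw [zero_add, sub_add_cancel] at h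
  refine h.congr fun s hs => ?_
  rw [Set.uIoc_of_le ht] at hs
  exact (if_neg (not_le.2 hs.1)).symm

theorem intervalIntegrable_concat (h₁ : 0 ≤ T₁) (h₂ : 0 ≤ T₂)
    (hf : IntervalIntegrable f volume 0 T₁) (hg : IntervalIntegrable g volume 0 T₂) :
    IntervalIntegrable (concat T₁ f g) volume 0 (T₁ + T₂) :=
  (intervalIntegrable_concat_left h₁ le_rfl hf).trans
    (intervalIntegrable_concat_right (by linarith) (by rwa [add_sub_cancel_left]))

theorem concat_mem_Icc {α : Type*} {f g : ℝ → α} {p : α → Prop}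
    (hf : ∀ t ∈ Set.Icc 0 T₁, p (f t)) (hg : ∀ t ∈ Set.Icc 0 T₂, p (g t)) :
    ∀ t ∈ Set.Icc 0 (T₁ + T₂), p (concat T₁ f g t) := by
  intro t ht
  unfold concat
  split_ifs with h
  · exact hf t ⟨ht.1, h⟩
  · exact hg _ ⟨by linarith, by linarith [ht.2]⟩

variable [NormedSpace ℝ F]

theorem integral_concat_left {t : ℝ} (ht0 : 0 ≤ t) (ht : t ≤ T₁) :
    ∫ s in (0 : ℝ)..t, concat T₁ f g s = ∫ s in (0 : ℝ)..t, f s := by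
  refine intervalIntegral.integral_congr fun s hs => ?_
  rw [Set.uIcc_of_le ht0] at hs
  exact if_pos (hs.2.trans ht)

theorem integral_concat_right {t : ℝ} (ht : T₁ ≤ t) :
    ∫ s in T₁..t, concat T₁ f g s = ∫ s in (0 : ℝ)..(t - T₁), g s := by
  have h : ∫ s in T₁..t, concat T₁ f g s = ∫ s in T₁..t, g (s - T₁) := by
    refine intervalIntegral.integral_congr_ae (Filter.Eventually.of_forall fun s hs => ?_)
    rw [Set.uIoc_of_le ht] at hs
    exact if_neg (not_le.2 hs.1)
  rw [h, intervalIntegral.integral_comp_sub_right, sub_self]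

end Concatenation

/-! ### Evolutions composed of reflections -/

section Pulses

variable {E : Type*} [NormedAddCommGroup E] [InnerProductSpace ℂ E]

/-- `φ` solves the Schrödinger equation with Hamiltonian `H` on `[0, T]`, in integrated form. -/
structure IsSolution (H : ℝ → E →L[ℂ] E) (T : ℝ) (φ : ℝ → E) : Prop where
  integrable : IntervalIntegrable (fun s => H s (φ s)) volume 0 T
  eq : ∀ t ∈ Set.Icc 0 T, φ t = φ 0 - Complex.I • ∫ s in (0 : ℝ)..t, H s (φ s)

theorem IsSolution.continuousOn {H : ℝ → E →L[ℂ] E} {T : ℝ} {φ : ℝ → E} (h : IsSolution H T φ)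
    (hT : 0 ≤ T) : ContinuousOn φ (Set.Icc 0 T) := by
  have h1 : ContinuousOn (fun t => ∫ s in (0 : ℝ)..t, H s (φ s)) (Set.Icc 0 T) := by
    have := intervalIntegral.continuousOn_primitive_interval'
      h.integrable Set.left_mem_uIcc
    rwa [Set.uIcc_of_le hT] at this
  exact (continuousOn_const.sub (h1.const_smul Complex.I)).congr h.eq

theorem IsSolution.concat {H₁ H₂ : ℝ → E →L[ℂ] E} {T₁ T₂ : ℝ} {φ₁ φ₂ : ℝ → E}
    (h₁ : IsSolution H₁ T₁ φ₁) (h₂ : IsSolution H₂ T₂ φ₂) (hT₁ : 0 ≤ T₁) (hT₂ : 0 ≤ T₂)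
    (h : φ₂ 0 = φ₁ T₁) :
    IsSolution (QueryConversion.concat T₁ H₁ H₂) (T₁ + T₂)
      (QueryConversion.concat T₁ φ₁ φ₂) := by
  have hH : (fun s => QueryConversion.concat T₁ H₁ H₂ s (QueryConversion.concat T₁ φ₁ φ₂ s)) =
      QueryConversion.concat T₁ (fun s => H₁ s (φ₁ s)) (fun s => H₂ s (φ₂ s)) := by
    funext s
    unfold QueryConversion.concat
    split_ifs <;> rfl
  have h0 : QueryConversion.concat T₁ φ₁ φ₂ 0 = φ₁ 0 := if_pos hT₁
  refine ⟨by rw [hH]; exact intervalIntegrable_concat hT₁ hT₂ h₁.integrable h₂.integrable,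
    fun t ht => ?_⟩
  rw [hH, h0]
  by_cases htT : t ≤ T₁
  · rw [integral_concat_left ht.1 htT, ← h₁.eq t ⟨ht.1, htT⟩]
    exact if_pos htT
  · have htT' := (not_le.1 htT).le
    have ht2 : t - T₁ ≤ T₂ := by linarith [ht.2]
    have hint : IntervalIntegrable (fun s => H₂ s (φ₂ s)) volume 0 (t - T₁) :=
      h₂.integrable.mono_set (by
        rw [Set.uIcc_of_le (by linarith), Set.uIcc_of_le hT₂]
        exact Set.Icc_subset_Icc le_rfl ht2)
    rw [← intervalIntegral.integral_add_adjacent_intervals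
      (intervalIntegrable_concat_left hT₁ le_rfl h₁.integrable)
      (intervalIntegrable_concat_right htT' hint), integral_concat_left hT₁ le_rfl,
      integral_concat_right htT', smul_add, ← sub_sub, ← h₁.eq T₁ ⟨hT₁, le_rfl⟩, ← h,
      ← h₂.eq _ ⟨by linarith, ht2⟩]
    exact if_neg htT

variable [CompleteSpace E]

/-- Evolving with a projection as the Hamiltonian. -/
theorem isSolution_projection {P : E →L[ℂ] E} (hP : IsIdempotentElem P) (T : ℝ) (ψ : E) :
    IsSolution (fun _ => P) T fun t => ψ + (Complex.exp (-Complex.I * t) - 1) • P ψ := by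
  have hPP : P (P ψ) = P ψ := congrArg (fun Q : E →L[ℂ] E => Q ψ) hP
  have hval : ∀ t : ℝ, P (ψ + (Complex.exp (-Complex.I * t) - 1) • P ψ) =
      Complex.exp (-Complex.I * t) • P ψ := by
    intro t
    rw [map_add, map_smul, hPP, sub_smul, one_smul, add_sub_cancel]
  have hder : ∀ t : ℝ, HasDerivAt (fun t : ℝ => Complex.exp (-Complex.I * t) • P ψ)
      (-Complex.I • Complex.exp (-Complex.I * t) • P ψ) t := by
    intro t
    have h1 : HasDerivAt (fun t : ℝ => -Complex.I * (t : ℂ)) (-Complex.I) t := by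
      simpa using (Complex.ofRealCLM.hasDerivAt (x := t)).const_mul (-Complex.I)
    have h2 := (h1.cexp).smul_const (P ψ)
    rwa [mul_comm, ← smul_smul] at h2
  constructor
  · simp only [hval]
    exact Continuous.intervalIntegrable (by fun_prop) _ _
  · intro t _
    have h2 := intervalIntegral.integral_eq_sub_of_hasDerivAt (fun s _ => hder s)
      (Continuous.intervalIntegrable (μ := volume) (a := 0) (b := t) (by fun_prop))
    rw [intervalIntegral.integral_smul, neg_smul] at h2
    simp only [hval]
    rw [sub_eq_add_neg (ψ + _) (Complex.I • _), h2]
    simp only [Complex.ofReal_zero, mul_zero, Complex.exp_zero, sub_self, zero_smul, add_zero,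
      one_smul, sub_smul]

/-- A choice of driver Hamiltonian and coupling on `[0, T]` makes the system with the oracle
Hamiltonians `P x` evolve by `U x`. -/
def Implements {ι : Type*} (P : ι → E →L[ℂ] E) (T : ℝ) (U : ι → E →L[ℂ] E) : Prop :=
  0 ≤ T ∧ ∃ (driver : ℝ → E →L[ℂ] E) (coupling : ℝ → ℝ),
    (∀ t ∈ Set.Icc 0 T, IsSelfAdjoint (driver t)) ∧ IntervalIntegrable driver volume 0 T ∧
    (∀ t ∈ Set.Icc 0 T, |coupling t| ≤ 1) ∧ IntervalIntegrable coupling volume 0 T ∧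
    ∀ x ψ, ∃ φ : ℝ → E, IsSolution (fun t => driver t + (coupling t : ℂ) • P x) T φ ∧
      φ 0 = ψ ∧ φ T = U x ψ

variable {ι : Type*} {P : ι → E →L[ℂ] E}

theorem implements_one : Implements P 0 fun _ => 1 := by
  refine ⟨le_rfl, 0, 0, fun _ _ => IsSelfAdjoint.zero _, IntervalIntegrable.refl, by simp,
    IntervalIntegrable.refl, fun x ψ => ⟨fun _ => ψ, ⟨IntervalIntegrable.refl, fun t ht => ?_⟩,
      rfl, rfl⟩⟩
  have : t = 0 := le_antisymm ht.2 ht.1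
  rw [this, intervalIntegral.integral_same, smul_zero, sub_zero]

theorem Implements.comp {T₁ T₂ : ℝ} {U₁ U₂ : ι → E →L[ℂ] E} (h₂ : Implements P T₂ U₂)
    (h₁ : Implements P T₁ U₁) : Implements P (T₁ + T₂) fun x => U₂ x * U₁ x := by
  obtain ⟨hT₁, d₁, c₁, hd₁, hdi₁, hc₁, hci₁, hU₁⟩ := h₁
  obtain ⟨hT₂, d₂, c₂, hd₂, hdi₂, hc₂, hci₂, hU₂⟩ := h₂
  refine ⟨add_nonneg hT₁ hT₂, concat T₁ d₁ d₂, concat T₁ c₁ c₂, concat_mem_Icc hd₁ hd₂,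
    intervalIntegrable_concat hT₁ hT₂ hdi₁ hdi₂,
    concat_mem_Icc (p := fun c : ℝ => |c| ≤ 1) hc₁ hc₂,
    intervalIntegrable_concat hT₁ hT₂ hci₁ hci₂, fun x ψ => ?_⟩
  obtain ⟨φ₁, hs₁, h0₁, hf₁⟩ := hU₁ x ψ
  obtain ⟨φ₂, hs₂, h0₂, hf₂⟩ := hU₂ x (U₁ x ψ)
  refine ⟨concat T₁ φ₁ φ₂, ?_, (if_pos hT₁).trans h0₁, ?_⟩
  · convert! hs₁.concat hs₂ hT₁ hT₂ (by rw [h0₂, hf₁]) using 1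
    funext t
    unfold concat
    split_ifs <;> rfl
  · unfold concat
    split_ifs with h
    · have hT : T₂ = 0 := by linarith
      subst hT
      rw [add_zero, hf₁, mul_apply_eq_comp, ← hf₂, h0₂]
    · rw [add_sub_cancel_left, hf₂, mul_apply_eq_comp]

theorem exp_neg_I_mul_pi_sub_one : Complex.exp (-Complex.I * (Real.pi : ℝ)) - 1 = -2 := by
  rw [neg_mul, Complex.exp_neg, mul_comm, Complex.exp_pi_mul_I]
  norm_num

/-- The reflection about the kernel of a projection `Q` is `exp (-i π Q)`. -/
theorem implements_driver_pulse {Q : E →L[ℂ] E} (hQ : IsStarProjection Q) :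
    Implements P Real.pi fun _ => 1 - (2 : ℂ) • Q := by
  refine ⟨Real.pi_pos.le, fun _ => Q, 0, fun _ _ => hQ.isSelfAdjoint, intervalIntegrable_const,
    by simp, intervalIntegrable_const, fun x ψ =>
    ⟨fun t => ψ + (Complex.exp (-Complex.I * t) - 1) • Q ψ, ?_, ?_, ?_⟩⟩
  · simpa using isSolution_projection hQ.isIdempotentElem Real.pi ψ
  · simp
  · beta_reduce
    rw [exp_neg_I_mul_pi_sub_one, neg_smul, ← sub_eq_add_neg]
    rfl

theorem implements_oracle_pulse (hP : ∀ x, IsStarProjection (P x)) :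
    Implements P Real.pi fun x => 1 - (2 : ℂ) • P x := by
  refine ⟨Real.pi_pos.le, 0, fun _ => 1, fun _ _ => IsSelfAdjoint.zero _, intervalIntegrable_const,
    by simp, intervalIntegrable_const, fun x ψ =>
    ⟨fun t => ψ + (Complex.exp (-Complex.I * t) - 1) • P x ψ, ?_, ?_, ?_⟩⟩
  · simpa using isSolution_projection (hP x).isIdempotentElem Real.pi ψ
  · simp
  · beta_reduce
    rw [exp_neg_I_mul_pi_sub_one, neg_smul, ← sub_eq_add_neg]
    rfl

/-- The product of the first `K` steps, step `k` being the reflection `1 - 2 P` followed by the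
reflection `1 - 2 Λ_k`. -/
def reflectionProduct (Q : E →L[ℂ] E) (Λ : ℕ → E →L[ℂ] E) : ℕ → E →L[ℂ] E
  | 0 => 1
  | K + 1 => (1 - (2 : ℂ) • Λ K) * ((1 - (2 : ℂ) • Q) * reflectionProduct Q Λ K)

theorem implements_reflectionProduct (hP : ∀ x, IsStarProjection (P x)) {Λ : ℕ → E →L[ℂ] E}
    (hΛ : ∀ k, IsStarProjection (Λ k)) (K : ℕ) :
    Implements P (2 * Real.pi * K) fun x => reflectionProduct (P x) Λ K := by
  induction K with
  | zero =>
    rw [Nat.cast_zero, mul_zero]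
    exact implements_one
  | succ K ih =>
    have := (implements_driver_pulse (hΛ K)).comp ((implements_oracle_pulse hP).comp ih)
    convert! this using 1
    push_cast
    ring

theorem norm_reflection_apply {Q : E →L[ℂ] E} (hQ : IsStarProjection Q) (ψ : E) :
    ‖(1 - (2 : ℂ) • Q) ψ‖ = ‖ψ‖ := by
  have hQQ : inner ℂ (Q ψ) (Q ψ) = inner ℂ ψ (Q ψ) := by
    have h1 := ContinuousLinearMap.isSelfAdjoint_iff_isSymmetric.1 hQ.isSelfAdjoint ψ (Q ψ)
    have h2 : Q (Q ψ) = Q ψ := congrArg (fun R : E →L[ℂ] E => R ψ) hQ.isIdempotentElem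
    rw [ContinuousLinearMap.coe_coe, h2] at h1
    exact h1
  have h3 : ‖Q ψ‖ ^ 2 = (inner ℂ ψ (Q ψ)).re := by
    rw [← hQQ, ← @inner_self_eq_norm_sq ℂ]
    rfl
  have h4 : ‖ψ - (2 : ℂ) • Q ψ‖ ^ 2 = ‖ψ‖ ^ 2 := by
    rw [@norm_sub_sq ℂ, inner_smul_right, norm_smul, mul_pow, h3]
    simp only [RCLike.re_to_complex, Complex.mul_re, Complex.re_ofNat, Complex.im_ofNat,
      Complex.norm_ofNat]
    ring
  exact (sq_eq_sq₀ (norm_nonneg _) (norm_nonneg _)).1 h4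

theorem norm_reflectionProduct_apply {Q : E →L[ℂ] E} (hQ : IsStarProjection Q)
    {Λ : ℕ → E →L[ℂ] E} (hΛ : ∀ k, IsStarProjection (Λ k)) (K : ℕ) (ψ : E) :
    ‖reflectionProduct Q Λ K ψ‖ = ‖ψ‖ := by
  induction K with
  | zero => rfl
  | succ K ih =>
    rw [reflectionProduct, mul_apply_eq_comp, norm_reflection_apply (hΛ K), mul_apply_eq_comp,
      norm_reflection_apply hQ, ih]

theorem reflection_span_apply [FiniteDimensional ℂ E] {s : Set E} {a b : E}
    (hab : a - b ∈ Submodule.span ℂ s) (h : ∀ w ∈ s, inner ℂ (a + b) w = 0) :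
    (1 - (2 : ℂ) • (Submodule.span ℂ s).starProjection) a = b := by
  have h1 : (Submodule.span ℂ s).starProjection (a - b) = a - b :=
    Submodule.starProjection_eq_self_iff.2 hab
  have h2 : (Submodule.span ℂ s).starProjection (a + b) = 0 := by
    rw [Submodule.starProjection_apply_eq_zero_iff, Submodule.mem_orthogonal']
    intro w hw
    induction hw using Submodule.span_induction with
    | mem w hw => exact h w hw
    | zero => exact inner_zero_right _
    | add a b _ _ ha hb => rw [inner_add_right, ha, hb, add_zero]
    | smul c a _ ha => rw [inner_smul_right, ha, mul_zero]
  rw [map_add] at h2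
  rw [map_sub] at h1
  change a - (2 : ℂ) • (Submodule.span ℂ s).starProjection a = b
  have h3 : (2 : ℂ) • (Submodule.span ℂ s).starProjection a = a - b := by
    rw [two_smul, ← h1]
    nth_rewrite 2 [eq_neg_of_add_eq_zero_left h2]
    abel
  rw [h3]
  abel

end Pulses

/-! ### Conversion in slots with a catalyst -/

section SlotAlgorithm

variable {S : Type u} [DecidableEq S] [Fintype S] {D : Type u} [Fintype D] {n m K : ℕ}
  {X : Finset (Fin n → S)}

/-- The vector `|k⟩ ⊗ w`, and `0` if `k ≥ K`. -/
def slotState (K k : ℕ) (w : EuclideanSpace ℂ D) : EuclideanSpace ℂ (Fin K × D) :=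
  WithLp.toLp 2 fun p => if (p.1 : ℕ) = k then w p.2 else 0

theorem inner_slotState {k l : ℕ} (hk : k < K) (v w : EuclideanSpace ℂ D) :
    inner ℂ (slotState K k v) (slotState K l w) = if k = l then inner ℂ v w else 0 := by
  simp only [slotState, PiLp.inner_apply, Fintype.sum_prod_type]
  rw [Finset.sum_eq_single (⟨k, hk⟩ : Fin K)]
  · by_cases h : k = l
    · simp [h]
    · simp [h]
  · intro i _ hi
    have : (i : ℕ) ≠ k := fun h => hi (Fin.ext h)
    simp [this]
  · simp

variable (n m) in
/-- The state with the first `k` of the `K` slots already converted. -/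
def progressState (K : ℕ) (r t : X → EuclideanSpace ℂ D) (x : X) (k : ℕ) :
    StateSpace (Bool × (Fin K × D)) (Option S × Fin m) n :=
  ∑ l ∈ Finset.range K, if l < k then outputState S n m true (slotState K l (t x))
    else outputState S n m false (slotState K l (r x))

/-- The vector `|0, k, ρ_x⟩ - |1, k, σ_x⟩ - √2 ∑ i, |i, x_i⁻⟩ |v_{x,i}⟩`. -/
def slotMinus (K : ℕ) (r t : X → EuclideanSpace ℂ D) (v : X → Fin n → EuclideanSpace ℂ (Fin m))
    (k : ℕ) (x : X) : StateSpace (Bool × (Fin K × D)) (Option S × Fin m) n :=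
  outputState S n m false (slotState K k (r x)) - outputState S n m true (slotState K k (t x)) -
    ((2 * (1 / √2) : ℝ) : ℂ) • queryState (Fin K × D) x.1 (v x)

/-- The projection on the span of the vectors `slotMinus K r t v k x`. -/
def slotProjection (K : ℕ) (r t : X → EuclideanSpace ℂ D)
    (v : X → Fin n → EuclideanSpace ℂ (Fin m)) (k : ℕ) :
    StateSpace (Bool × (Fin K × D)) (Option S × Fin m) n →L[ℂ]
      StateSpace (Bool × (Fin K × D)) (Option S × Fin m) n :=
  (Submodule.span ℂ (Set.range (slotMinus K r t v k))).starProjection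

theorem slotProjection_isStarProjection (r t : X → EuclideanSpace ℂ D)
    (v : X → Fin n → EuclideanSpace ℂ (Fin m)) (k : ℕ) :
    IsStarProjection (slotProjection K r t v k) :=
  isStarProjection_starProjection

/-- The catalyst `(∑ i, |i, x_i⁺⟩ |u_{x,i}⟩ + ∑ i, |i, x_i⁻⟩ |v_{x,i}⟩) / √2`. -/
def catalyst (D : Type u) (u v : X → Fin n → EuclideanSpace ℂ (Fin m)) (x : X) :
    StateSpace (Bool × D) (Option S × Fin m) n :=
  ((1 / √2 : ℝ) : ℂ) • (plusQueryState D x.1 (u x) + queryState D x.1 (v x))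

variable {ρ σ : Matrix X X ℂ} {r t : X → EuclideanSpace ℂ D}
  {u v : X → Fin n → EuclideanSpace ℂ (Fin m)} {W ε : ℝ}

theorem norm_sq_catalyst_le (h : IsWitness (ρ - σ) (filterMatrix X) W u v) (x : X) :
    ‖catalyst D u v x‖ ^ 2 ≤ W := by
  have hz : ‖((1 / √2 : ℝ) : ℂ)‖ ^ 2 = 1 / 2 := by
    rw [sq, ← norm_mul, inv_sqrt_two_mul_self]; norm_num
  rw [catalyst, norm_smul, mul_pow, hz, @norm_add_sq ℂ, inner_plusQueryState_queryState_self,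
    norm_sq_plusQueryState, norm_sq_queryState]
  have h1 := h.left_le x
  have h2 := h.right_le x
  simp only [map_zero, mul_zero, add_zero]
  linarith

variable (r t) in
/-- The part of `progressState` outside the slot `k`. -/
theorem progressState_eq {k : ℕ} (hk : k < K) (x : X) :
    ∃ c : StateSpace (Bool × (Fin K × D)) (Option S × Fin m) n,
      progressState n m K r t x k = c + outputState S n m false (slotState K k (r x)) ∧
      progressState n m K r t x (k + 1) = c + outputState S n m true (slotState K k (t x)) ∧
      oracleProjection (Fin K × D) m x.1 c = 0 ∧
      ∀ y v, inner ℂ c (slotMinus K r t v k y) = 0 := by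
  refine ⟨∑ l ∈ (Finset.range K).erase k,
    if l < k then outputState S n m true (slotState K l (t x))
    else outputState S n m false (slotState K l (r x)), ?_, ?_, ?_, fun y v => ?_⟩
  · rw [progressState, ← Finset.sum_erase_add _ _ (Finset.mem_range.2 hk), if_neg (lt_irrefl k)]
  · rw [progressState, ← Finset.sum_erase_add _ _ (Finset.mem_range.2 hk), if_pos (Nat.lt_succ_self k)]
    congr 1
    refine Finset.sum_congr rfl fun l hl => ?_
    have hne := (Finset.mem_erase.1 hl).1
    have : l < k + 1 ↔ l < k := by omega
    simp only [this]
  · rw [map_sum]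
    refine Finset.sum_eq_zero fun l _ => ?_
    split_ifs <;> exact oracleProjection_outputState _ _ _
  · rw [sum_inner]
    refine Finset.sum_eq_zero fun l hl => ?_
    obtain ⟨hne, hlK⟩ := Finset.mem_erase.1 hl
    rw [Finset.mem_range] at hlK
    split_ifs <;>
    simp only [slotMinus, inner_sub_right, inner_smul_right, inner_outputState,
      queryState_eq_registerState, inner_outputState_registerState, inner_slotState hlK, if_neg hne,
      ite_self, mul_zero, sub_zero]

theorem reflection_oracle_catalyst (x : X) :
    (1 - (2 : ℂ) • oracleProjection D m x.1) (catalyst D u v x) =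
      ((1 / √2 : ℝ) : ℂ) • (plusQueryState D x.1 (u x) - queryState D x.1 (v x)) := by
  change catalyst D u v x - (2 : ℂ) • oracleProjection D m x.1 (catalyst D u v x) = _
  rw [catalyst, map_smul, map_add, oracleProjection_plusQueryState, oracleProjection_queryState]
  module

/-- In the presence of the catalyst, each step converts one more slot exactly. -/
theorem step_progressState (hr : HasGram r ρ) (ht : HasGram t σ)
    (h : IsWitness (ρ - σ) (filterMatrix X) W u v) {k : ℕ} (hk : k < K) (x : X) :
    (1 - (2 : ℂ) • slotProjection K r t v k)
      ((1 - (2 : ℂ) • oracleProjection (Fin K × D) m x.1)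
        (progressState n m K r t x k + catalyst (Fin K × D) u v x)) =
      progressState n m K r t x (k + 1) + catalyst (Fin K × D) u v x := by
  obtain ⟨c, hc1, hc2, hc3, hc4⟩ := progressState_eq (m := m) r t hk x
  have h1 : (1 - (2 : ℂ) • oracleProjection (Fin K × D) m x.1) (progressState n m K r t x k) =
      progressState n m K r t x k := by
    change progressState n m K r t x k -
      (2 : ℂ) • oracleProjection (Fin K × D) m x.1 (progressState n m K r t x k) = _
    rw [hc1, map_add, hc3, oracleProjection_outputState, add_zero, smul_zero, sub_zero]
  rw [map_add, h1, reflection_oracle_catalyst, slotProjection]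
  refine reflection_span_apply ?_ ?_
  · have : progressState n m K r t x k + ((1 / √2 : ℝ) : ℂ) •
        (plusQueryState (Fin K × D) x.1 (u x) - queryState (Fin K × D) x.1 (v x)) -
        (progressState n m K r t x (k + 1) + catalyst (Fin K × D) u v x) =
        slotMinus K r t v k x := by
      rw [hc1, hc2, catalyst, slotMinus]
      push_cast
      module
    rw [this]
    exact Submodule.subset_span ⟨x, rfl⟩
  · rintro _ ⟨y, rfl⟩
    have hsum : progressState n m K r t x k + ((1 / √2 : ℝ) : ℂ) •
        (plusQueryState (Fin K × D) x.1 (u x) - queryState (Fin K × D) x.1 (v x)) +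
        (progressState n m K r t x (k + 1) + catalyst (Fin K × D) u v x) =
        (2 : ℂ) • c + (outputState S n m false (slotState K k (r x)) +
          outputState S n m true (slotState K k (t x)) +
          (2 * ((1 / √2 : ℝ) : ℂ)) • plusQueryState (Fin K × D) x.1 (u x)) := by
      rw [hc1, hc2, catalyst]
      module
    rw [hsum, inner_add_left, inner_smul_left, hc4, mul_zero, zero_add, slotMinus]
    have h0 := inner_plusQueryState_queryState (D := Fin K × D) h x y
    have h2 := inv_sqrt_two_mul_self
    simp only [plusQueryState, queryState_eq_registerState] at h0
    simp only [inner_add_left, inner_sub_right, inner_smul_left, inner_smul_right,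
      inner_outputState, inner_slotState hk, hr x y, ht x y, plusQueryState,
      queryState_eq_registerState, inner_outputState_registerState,
      inner_registerState_outputState, h0, map_mul, Complex.conj_ofReal, Complex.conj_ofNat,
      if_true, Bool.false_eq_true, Bool.true_eq_false, if_false, Matrix.sub_apply, mul_zero,
      add_zero]
    push_cast at h2 ⊢
    linear_combination (-2 * (ρ x y - σ x y)) * h2

theorem reflectionProduct_progressState (hr : HasGram r ρ) (ht : HasGram t σ)
    (h : IsWitness (ρ - σ) (filterMatrix X) W u v) (x : X) {k : ℕ} (hk : k ≤ K) :
    reflectionProduct (oracleProjection (Fin K × D) m x.1) (slotProjection K r t v) k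
      (progressState n m K r t x 0 + catalyst (Fin K × D) u v x) =
      progressState n m K r t x k + catalyst (Fin K × D) u v x := by
  induction k with
  | zero => rfl
  | succ k ih =>
    rw [reflectionProduct, mul_apply_eq_comp, mul_apply_eq_comp, ih (by omega)]
    exact step_progressState hr ht h (by omega) x

/-- A uniform superposition over the slots has the same Gram matrix. -/
theorem inner_uniform_superposition (hK : 0 < K) (b : Bool) (w w' : EuclideanSpace ℂ D) :
    inner ℂ (((1 / √(K : ℝ) : ℝ) : ℂ) •
        ∑ l ∈ Finset.range K, outputState S n m b (slotState K l w))
      (((1 / √(K : ℝ) : ℝ) : ℂ) • ∑ l ∈ Finset.range K, outputState S n m b (slotState K l w')) =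
      inner ℂ w w' := by
  have hK' : ((1 / √(K : ℝ) : ℝ) : ℂ) * ((1 / √(K : ℝ) : ℝ) : ℂ) * K = 1 := by
    rw [← Complex.ofReal_mul, one_div_mul_one_div, Real.mul_self_sqrt (Nat.cast_nonneg K)]
    push_cast
    have : (K : ℂ) ≠ 0 := by exact_mod_cast hK.ne'
    field_simp
  have h1 : inner ℂ (∑ l ∈ Finset.range K, outputState S n m b (slotState K l w))
      (∑ l ∈ Finset.range K, outputState S n m b (slotState K l w')) = K * inner ℂ w w' := by
    rw [sum_inner]
    calc _ = ∑ i ∈ Finset.range K, inner ℂ w w' := Finset.sum_congr rfl fun i hi => by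
            simp only [inner_sum, inner_outputState, if_true,
              inner_slotState (Finset.mem_range.1 hi), Finset.sum_ite_eq, if_pos hi]
      _ = _ := by rw [Finset.sum_const, Finset.card_range, nsmul_eq_mul]
  rw [inner_smul_left, inner_smul_right, h1, Complex.conj_ofReal]
  linear_combination (inner ℂ w w') * hK'

theorem hasGram_progressState_zero (hr : HasGram r ρ) (hK : 0 < K) :
    HasGram (fun x => ((1 / √(K : ℝ) : ℝ) : ℂ) • progressState n m K r t x 0) ρ :=
  fun x y => (inner_uniform_superposition hK false (r x) (r y)).trans (hr x y)

theorem hasGram_progressState_last (ht : HasGram t σ) (hK : 0 < K) :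
    HasGram (fun x => ((1 / √(K : ℝ) : ℝ) : ℂ) • progressState n m K r t x K) σ := by
  have h0 : ∀ x, progressState n m K r t x K =
      ∑ l ∈ Finset.range K, outputState S n m true (slotState K l (t x)) := fun x =>
    Finset.sum_congr rfl fun l hl => if_pos (Finset.mem_range.1 hl)
  simp only [h0]
  exact fun x y => (inner_uniform_superposition hK true (t x) (t y)).trans (ht x y)

/-- An evolution of the standard oracle that approximately converts states yields an algorithm. -/
theorem solvableInTime_of_implements {T : ℝ}
    {U : (Fin n → S) → StateSpace (Bool × D) (Option S × Fin m) n →L[ℂ]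
      StateSpace (Bool × D) (Option S × Fin m) n}
    (hU : Implements (oracleProjection D m) T U)
    {init target : X → StateSpace (Bool × D) (Option S × Fin m) n} (hi : HasGram init ρ)
    (ht : HasGram target σ)
    (h : ∀ x, √(1 - ε) ≤ (inner ℂ (target x) (U x.1 (init x))).re) :
    SolvableInTime ρ σ ε T := by
  obtain ⟨hT, d, c, hd, hdi, hc, hci, hφ⟩ := hU
  refine ⟨⟨Bool × D, Option S × Fin m, standardOracle m, T, d, c⟩,
    ⟨hT, fun y => (standardOracle_isStarProjection m y).isSelfAdjoint,
    fun y => (standardOracle_isStarProjection m y).norm_le, hd, hdi, hc, hci⟩, rfl, init, target,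
    hi, ht, fun x => ?_⟩
  obtain ⟨φ, hs, h0, hfin⟩ := hφ x.1 (init x)
  refine ⟨φ, ⟨hs.continuousOn hT, hs.eq⟩, h0, ?_⟩
  have := h x
  rw [← hfin] at this
  exact this

/-- `K` slots suffice as soon as `K ≥ 4 W / ε`: leaving out the catalyst costs a distance
`2 √(W / K)`. -/
theorem solvableInTime_slots (hρ : IsGram ρ) (hσ : IsGram σ)
    (h : IsWitness (ρ - σ) (filterMatrix X) W u v) (hε1 : ε ≤ 1) (hK : 0 < K)
    (hKW : 4 * W ≤ ε * K) : SolvableInTime ρ σ ε (2 * Real.pi * K) := by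
  obtain ⟨r, hr⟩ := exists_hasGram hρ.1
  obtain ⟨t, ht⟩ := exists_hasGram hσ.1
  have hi := hasGram_progressState_zero (S := S) (n := n) (m := m) (t := t) hr hK
  have hf := hasGram_progressState_last (S := S) (n := n) (m := m) (r := r) ht hK
  have hP : ∀ x : Fin n → S, IsStarProjection (oracleProjection (Fin K × X) m x) :=
    oracleProjection_isStarProjection
  have hΛ := slotProjection_isStarProjection (K := K) r t v
  refine solvableInTime_of_implements (implements_reflectionProduct hP hΛ K) hi hf fun x => ?_
  set z : ℂ := ((1 / √(K : ℝ) : ℝ) : ℂ) with hz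
  have hK' : (0 : ℝ) < K := by exact_mod_cast hK
  have hzn : ‖z‖ ^ 2 = 1 / K := by
    rw [hz, Complex.norm_real, Real.norm_eq_abs, sq_abs, div_pow, one_pow, Real.sq_sqrt hK'.le]
  have hn1 := norm_reflectionProduct_apply (hP x.1) hΛ K
  refine sqrt_le_re_inner_of_norm_sub (hf.norm_eq_one hσ x) ?_ hε1 ?_
  · rw [hn1]
    exact hi.norm_eq_one hρ x
  · have hstep := reflectionProduct_progressState hr ht h x (le_refl K)
    have hdiff : reflectionProduct (oracleProjection (Fin K × X) m x.1) (slotProjection K r t v) K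
        (z • progressState n m K r t x 0) - z • progressState n m K r t x K =
        z • (catalyst (Fin K × X) u v x - reflectionProduct (oracleProjection (Fin K × X) m x.1)
          (slotProjection K r t v) K (catalyst (Fin K × X) u v x)) := by
      rw [map_add, ← eq_sub_iff_add_eq] at hstep
      rw [map_smul, hstep]
      module
    have hcat := norm_sq_catalyst_le (D := Fin K × X) h x
    have htri : ‖catalyst (Fin K × X) u v x - reflectionProduct
        (oracleProjection (Fin K × X) m x.1) (slotProjection K r t v) K
        (catalyst (Fin K × X) u v x)‖ ≤ 2 * ‖catalyst (Fin K × X) u v x‖ := by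
      refine (norm_sub_le _ _).trans ?_
      rw [hn1]
      linarith
    rw [hdiff, norm_smul, mul_pow, hzn]
    calc 1 / (K : ℝ) * _ ^ 2 ≤ 1 / K * (2 * ‖catalyst (Fin K × X) u v x‖) ^ 2 := by gcongr
      _ ≤ 1 / K * (4 * W) := by rw [mul_pow]; gcongr; linarith
      _ ≤ 1 / K * (ε * K) := by gcongr
      _ = ε := by field_simp

theorem queryComplexity_le (hρ : IsGram ρ) (hσ : IsGram σ) (hε : 0 < ε) (hε1 : ε ≤ 1) :
    queryComplexity ε ρ σ ≤ ENNReal.ofReal (40 * advStar ρ σ / ε) := by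
  by_cases hW : advStar ρ σ < ε / 2
  · refine (iInf₂_le 0 (solvableInTime_zero hρ hσ hε1 hW)).trans ?_
    simp
  · push Not at hW
    obtain ⟨m, u, v, h⟩ := exists_isWitness_advStar hρ hσ
    set W := advStar ρ σ
    set K := ⌈4 * W / ε⌉₊ with hK
    have hWε : 1 / 2 ≤ W / ε := by rw [le_div_iff₀ hε]; linarith
    have hKpos : 0 < K := Nat.ceil_pos.2 (by rw [mul_div_assoc]; linarith)
    have hKge : 4 * W / ε ≤ K := Nat.le_ceil _
    have hKle : (K : ℝ) ≤ 6 * (W / ε) := by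
      have := Nat.ceil_lt_add_one (a := 4 * W / ε) (by rw [mul_div_assoc]; linarith)
      rw [mul_div_assoc] at this
      rw [hK, mul_div_assoc]
      linarith
    refine (iInf₂_le (2 * Real.pi * K) (solvableInTime_slots hρ hσ h hε1 hKpos ?_)).trans ?_
    · rw [div_le_iff₀ hε] at hKge
      linarith
    · refine ENNReal.ofReal_le_ofReal ?_
      have hpi : 2 * Real.pi ≤ 20 / 3 := by linarith [Real.pi_lt_d2]
      calc 2 * Real.pi * K ≤ 20 / 3 * (6 * (W / ε)) := by gcongr
        _ = 40 * W / ε := by ring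

end SlotAlgorithm

end QueryConversion

end

theorem theorem2 :
    -- the bound on the query complexity, with a universal constant
    (∃ C : ℝ, 0 < C ∧
      ∀ (S : Type u) [Fintype S] [DecidableEq S] (n : ℕ) (X : Finset (Fin n → S))
        (ρ σ : Matrix X X ℂ), QueryConversion.IsGram ρ → QueryConversion.IsGram σ →
        ∀ ε : ℝ, 0 < ε → ε ≤ 1 →
          QueryConversion.queryComplexity ε ρ σ ≤
            ENNReal.ofReal (C * QueryConversion.advStar ρ σ / ε)) ∧
    -- the algorithm AdiaConvert
    (∀ (S : Type u) [Fintype S] [DecidableEq S] (n : ℕ) (X : Finset (Fin n → S))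
        (ρ σ : Matrix X X ℂ), QueryConversion.IsGram ρ → QueryConversion.IsGram σ →
        -- optimal witnesses of the adversary bound exist
        (∃ (m : ℕ) (u v : X → Fin n → EuclideanSpace ℂ (Fin m)),
          QueryConversion.IsWitness (ρ - σ) (QueryConversion.filterMatrix X)
            (QueryConversion.advStar ρ σ) u v) ∧
        -- small adversary bound: doing nothing has error at most ε
        (∀ ε : ℝ, 0 < ε → ε ≤ 1 → QueryConversion.advStar ρ σ < ε / 2 →
          QueryConversion.SolvableInTime ρ σ ε 0) ∧
        -- otherwise, the adiabatic evolution has error at most 9ε², for all states with the given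
        -- Gram matrices and for every optimal witness
        (∀ ε : ℝ, 0 < ε → 9 * ε ^ 2 ≤ 1 → ε / 2 ≤ QueryConversion.advStar ρ σ →
          ∀ (D : Type u) [Fintype D] (r t : X → EuclideanSpace ℂ D),
            QueryConversion.HasGram r ρ → QueryConversion.HasGram t σ →
          ∀ (m : ℕ) (u v : X → Fin n → EuclideanSpace ℂ (Fin m)),
            QueryConversion.IsWitness (ρ - σ) (QueryConversion.filterMatrix X)
              (QueryConversion.advStar ρ σ) u v →
            (QueryConversion.adiaConvert (QueryConversion.advStar ρ σ) ε r t v).IsValid ∧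
            (QueryConversion.adiaConvert (QueryConversion.advStar ρ σ) ε r t v).ConvertsStates
              (fun x => QueryConversion.outputState S n m false (r x))
              (fun x => QueryConversion.outputState S n m true (t x))
              (9 * ε ^ 2))) := by
  refine ⟨⟨40, by norm_num, ?_⟩, ?_⟩
  · intro S _ _ n X ρ σ hρ hσ ε hε hε1
    exact QueryConversion.queryComplexity_le hρ hσ hε hε1
  · intro S _ _ n X ρ σ hρ hσ
    refine ⟨QueryConversion.exists_isWitness_advStar hρ hσ, ?_, ?_⟩
    · intro ε _ hε1 hW
      exact QueryConversion.solvableInTime_zero hρ hσ hε1 hW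
    · intro ε hε hε1 hW D _ r t hr ht m u v h
      exact ⟨QueryConversion.adiaConvert_isValid h.nonneg r t v,
        QueryConversion.adiaConvert_convertsStates hρ hσ hr ht h hε hε1 hW⟩
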